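/- Let $X_1$ be a complex separable Hilbert space, let $A_1$ generate a strongly continuous ($C_0$-) semigroup $S_1(t)$ on $X_1$, let $b_1\in X_1$ and $t_1>0$, and consider the equation with scalar control $$\dot x_1(t)=A_1x_1(t)+b_1v(t),\qquad x_1(0)=x_1^0, \tag{1.1}$$ with mild solution $x_1(t)=S_1(t)x_1^0+\int_0^tS_1(t-\tau)b_1v(\tau)\,d\tau$. Assume that the spectrum $\sigma_1$ of $A_1$ consists of simple eigenvalues $\lambda_j$ (of algebraic multiplicity one, listed without repetition), that it has no finite limit points, and that corresponding eigenvectors $\varphi_j$ of $A_1$ form a Riesz basis of $X_1$. Let $\psi_j$ be the eigenvectors of the adjoint operator, $A_1^*\psi_j=\overline{\lambda_j}\psi_j$, normalized by $(\varphi_i,\psi_j)=\delta_{ij}$, and put $b_{1j}=(b_1,\psi_j)$. If $0\in\sigma_1$, the index $0$ is used for the eigenvalue $\lambda_0=0$; thus $\lambda_j\neq 0$ for $j\ge 1$. Equation (1.1) is called exactly null-controllable on $[0,t_1]$ by smooth controls if for every $x_1^0\in X_1$ and every $a\in\mathbb C$ there is an absolutely continuous function $v$ on $[0,t_1]$ with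 $v'\in L^2[0,t_1]$, $v(0)=a$ and $v(t_1)=0$, such that $x_1(t_1)=0$. A family $\{x_k\}$ in a Hilbert space is called strongly minimal if there is $\gamma>0$ such that $\gamma\sum|c_k|^2\le\|\sum c_kx_k\|^2$ for all finite families of complex coefficients $c_k$. **Theorem 3.1.** Equation (1.1) is exactly null-controllable on $[0,t_1]$ by smooth controls if and only if the following two conditions hold: 1. either $0\notin\sigma_1$, or $0\in\sigma_1$ and $b_{10}\ne0$; 2. the family $\left\{1,\ \frac{b_{1j}}{\lambda_j}e^{-\lambda_jt},\ j=1,2,\dots\right\}$ (over all nonzero eigenvalues $\lambda_j$) is strongly minimal in $L^2[0,t_1]$. -/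

import Mathlib

open MeasureTheory Set Filter Topology
open scoped ComplexConjugate LinearPMap

namespace NullControl

section Semigroups

variable {X : Type*} [NormedAddCommGroup X] [InnerProductSpace ℂ X]

/-- A strongly continuous (`C₀`-) semigroup of bounded operators on `X`. Only the values at
times `t ≥ 0` are constrained, and only these are ever used. -/
structure C0Semigroup (X : Type*) [NormedAddCommGroup X] [InnerProductSpace ℂ X] where
  /-- the operator at time `t` -/
  op : ℝ → X →L[ℂ] X
  op_zero : op 0 = ContinuousLinearMap.id ℂ X
  op_add : ∀ s t : ℝ, 0 ≤ s → 0 ≤ t → op (s + t) = (op s).comp (op t)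
  strongly_continuous : ∀ x : X, ContinuousOn (fun t => op t x) (Ici 0)

/-- The (unbounded) operator `A` is the infinitesimal generator of the semigroup `S`: the domain
of `A` is the set of all `x` for which `lim_{h → 0+} (S(h) x - x) / h` exists, and `A x` is this
limit. -/
def C0Semigroup.IsGenerator (S : C0Semigroup X) (A : X →ₗ.[ℂ] X) : Prop :=
  ∀ x y : X, (x, y) ∈ A.graph ↔
    Tendsto (fun h : ℝ => ((h⁻¹ : ℝ) : ℂ) • (S.op h x - x)) (𝓝[>] 0) (𝓝 y)

/-- `x` is an eigenvector of the unbounded operator `A` with eigenvalue `μ`. -/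
def IsEigenvector (A : X →ₗ.[ℂ] X) (μ : ℂ) (x : X) : Prop :=
  x ≠ 0 ∧ ∃ hx : x ∈ A.domain, A ⟨x, hx⟩ = μ • x

/-- `μ` is a simple eigenvalue of `A` (algebraic multiplicity one): there is an eigenvector `x`,
every eigenvector for `μ` is a multiple of `x` (the case `c = 0`), and `x` has no associated
vector (the case `c ≠ 0`). -/
def IsSimpleEigenvalue (A : X →ₗ.[ℂ] X) (μ : ℂ) : Prop :=
  ∃ x : X, IsEigenvector A μ x ∧
    ∀ y : A.domain, (∃ c : ℂ, A y - μ • (y : X) = c • x) → ∃ d : ℂ, (y : X) = d • x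

/-- `μ` is a regular value of `A`: the operator `μ - A : D(A) → X` has a bounded everywhere
defined two-sided inverse. -/
def IsRegularValue (A : X →ₗ.[ℂ] X) (μ : ℂ) : Prop :=
  ∃ R : X →L[ℂ] X,
    (∀ x : X, ∃ hx : R x ∈ A.domain, μ • R x - A ⟨R x, hx⟩ = x) ∧
    (∀ y : A.domain, R (μ • (y : X) - A y) = y)

/-- The spectrum of an unbounded operator. -/
def opSpectrum (A : X →ₗ.[ℂ] X) : Set ℂ := {μ | ¬ IsRegularValue A μ}

/-- A Riesz basis of `X`: a complete family whose finite linear combinations have a norm which is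
equivalent to the `ℓ²`-norm of the coefficients. -/
def IsRieszBasis {ι : Type*} (φ : ι → X) : Prop :=
  (Submodule.span ℂ (range φ)).topologicalClosure = ⊤ ∧
  ∃ m M : ℝ, 0 < m ∧ 0 < M ∧ ∀ (s : Finset ι) (c : ι → ℂ),
    m * ∑ i ∈ s, ‖c i‖ ^ 2 ≤ ‖∑ i ∈ s, c i • φ i‖ ^ 2 ∧
    ‖∑ i ∈ s, c i • φ i‖ ^ 2 ≤ M * ∑ i ∈ s, ‖c i‖ ^ 2

/-- A family is strongly minimal if for some `γ > 0` the inequality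
`γ ∑ |c_k|² ≤ ‖∑ c_k x_k‖²` holds for all finite linear combinations. -/
def IsStronglyMinimal {κ : Type*} (x : κ → X) : Prop :=
  ∃ γ : ℝ, 0 < γ ∧ ∀ (s : Finset κ) (c : κ → ℂ),
    γ * ∑ k ∈ s, ‖c k‖ ^ 2 ≤ ‖∑ k ∈ s, c k • x k‖ ^ 2

/-- The mild solution at time `t` of `x' = A x + b v`, `x(0) = x₀`, where `A` generates `S`:
`x(t) = S(t) x₀ + ∫₀ᵗ S(t - τ) b v(τ) dτ`. -/
noncomputable def mildSolution (S : C0Semigroup X) (b x₀ : X) (v : ℝ → ℂ) (t : ℝ) : X :=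
  S.op t x₀ + ∫ τ in (0 : ℝ)..t, S.op (t - τ) (v τ • b)

/-- `v` belongs to `H¹[0, t₁]` (that is, `v` is absolutely continuous on `[0, t₁]` with `v'` in
`L²[0, t₁]`) and has the boundary values `v(0) = a`, `v(t₁) = β`. -/
def MemH1 (t₁ : ℝ) (a β : ℂ) (v : ℝ → ℂ) : Prop :=
  AbsolutelyContinuousOnInterval v 0 t₁ ∧
  MemLp (deriv v) 2 (volume.restrict (Icc 0 t₁)) ∧ v 0 = a ∧ v t₁ = β

/-- Exact null-controllability of `x' = A x + b v` on `[0, t₁]` by smooth controls: every initial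
state is steered to zero at time `t₁` by an `H¹`-control with any prescribed value at time `0`
and the value zero at time `t₁`. -/
def ExactNullControllableSmooth (S : C0Semigroup X) (b : X) (t₁ : ℝ) : Prop :=
  ∀ (x₀ : X) (a : ℂ), ∃ v : ℝ → ℂ, MemH1 t₁ a 0 v ∧ mildSolution S b x₀ v t₁ = 0

end Semigroups

/-- The element of `L²[0, t₁]` given by a continuous function. -/
noncomputable def toL2 (t₁ : ℝ) (f : ℝ → ℂ) (hf : Continuous f) :
    Lp ℂ 2 (volume.restrict (Icc (0 : ℝ) t₁)) :=
  MemLp.toLp f ((memLp_two_iff_integrable_sq_norm hf.aestronglyMeasurable).2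
    ((hf.norm.pow 2).continuousOn.integrableOn_compact isCompact_Icc))

/-- The family `{1, (β_j / λ_j) e^{-λ_j t}}` in `L²[0, t₁]`, where `j` runs over the indices with
`λ_j ≠ 0`; the index `none` carries the constant function `1`. -/
noncomputable def expFamily {ι : Type*} (t₁ : ℝ) (lam β : ι → ℂ) :
    Option {j : ι // lam j ≠ 0} → Lp ℂ 2 (volume.restrict (Icc (0 : ℝ) t₁))
  | none => toL2 t₁ (fun _ => 1) continuous_const
  | some j => toL2 t₁ (fun t => β j / lam j * Complex.exp (-lam j * t)) (by fun_prop)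

end NullControl

/-! The idea is to turn controllability into a moment problem for `u = v'`. Tested against `ψ j`,
the condition `x(T) = 0` reads `x₀ⱼ + bⱼ ∫ e^{-λⱼt} v = 0`. Integrating by parts with `v(0) = a`,
`v(T) = 0` gives, for `λⱼ ≠ 0`, the moment of `u` against `(bⱼ/λⱼ) e^{-λⱼt}`. The boundary values
themselves give the moment `-a` against `1`, and a zero eigenvalue gives `b₀ ∫ t u = x₀₀`
(`mildSolution_eq_zero_iff_deriv`). By the Riesz basis property, arbitrary `x₀` and `a` produce
arbitrary square summable right-hand sides for the family.

A family has a solvable moment problem for all square summable data exactly when it is strongly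
minimal: Hahn-Banach in one direction (`IsStronglyMinimal.exists_inner_eq`), Banach-Steinhaus in the
other (`isStronglyMinimal_of_forall_exists`). This gives necessity; `b₀ ≠ 0` is forced by starting
at the eigenvector of the eigenvalue `0`.

For sufficiency the moment against `t` must be prescribed as well, so `t` must lie outside the
closed span of the family. Suppose it does not. Any `u` orthogonal to the family then has a Laplace
transform with a double zero at `0`. Dividing by `z` gives the transform of another such function,
so the zero has infinite order and `u = 0` on all exponentials: the family spans every `e^{-zt}`
(`laplace_eq_zero_of_forall`).

Such completeness contradicts strong minimality (`not_forall_mem_closure_span`). Choose `k` whose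
transform is `1` at all exponents and put `G = 1 - laplace k`. The functions `G(z)/(z - μⱼ)` are
transforms of a biorthogonal family up to scalars, and expanding `e^{-zt}` yields `1/G = 1 + ∑ mⱼ/(z
- μⱼ)` with `∑ |mⱼ| < ∞`. Zero counting provides large circles away from the `μⱼ`, on which `G` is
bounded. By Liouville `G` is constant, although it vanishes at the `μⱼ` and is not identically zero.
-/

namespace NullControl

/-! ### Square summable families. -/

section SquareSummable

variable {κ : Type*}

lemma memℓp_two_of_summable {d : κ → ℂ} (hd : Summable fun k => ‖d k‖ ^ 2) : Memℓp d 2 :=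
  memℓp_gen (by simpa using hd)

lemma summable_sq_norm_lp (d : lp (fun _ : κ => ℂ) 2) : Summable fun k => ‖d k‖ ^ 2 := by
  simpa using (lp.memℓp d).summable (by norm_num)

lemma norm_sq_sum_single [DecidableEq κ] (s : Finset κ) (c : κ → ℂ) :
    ‖∑ k ∈ s, lp.single (E := fun _ : κ => ℂ) 2 k (c k)‖ ^ 2 = ∑ k ∈ s, ‖c k‖ ^ 2 := by
  have := lp.norm_sum_single (E := fun _ : κ => ℂ) (p := 2) (by norm_num) c s
  simpa using this

lemma summable_norm_mul_of_sq {c d : κ → ℂ} (hc : Summable fun k => ‖c k‖ ^ 2)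
    (hd : Summable fun k => ‖d k‖ ^ 2) : Summable fun k => ‖c k * d k‖ := by
  refine Summable.of_nonneg_of_le (fun _ => norm_nonneg _) (fun k => ?_) (hc.add hd)
  rw [norm_mul]
  nlinarith [sq_nonneg (‖c k‖ - ‖d k‖), sq_nonneg (‖c k‖), sq_nonneg (‖d k‖)]

lemma summable_sq_add {c d : κ → ℂ} (hc : Summable fun k => ‖c k‖ ^ 2)
    (hd : Summable fun k => ‖d k‖ ^ 2) : Summable fun k => ‖c k + d k‖ ^ 2 := by
  refine Summable.of_nonneg_of_le (fun _ => by positivity) (fun k => ?_)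
    ((hc.mul_left 2).add (hd.mul_left 2))
  have := norm_add_le (c k) (d k)
  nlinarith [sq_nonneg (‖c k‖ - ‖d k‖), norm_nonneg (c k + d k), norm_nonneg (c k),
    norm_nonneg (d k)]

lemma summable_sq_of_le {c d : κ → ℂ} {C : ℝ} (hd : Summable fun k => ‖d k‖ ^ 2)
    (h : ∀ k, ‖c k‖ ≤ C * ‖d k‖) : Summable fun k => ‖c k‖ ^ 2 := by
  refine Summable.of_nonneg_of_le (fun _ => by positivity) (fun k => ?_) (hd.mul_left (C ^ 2))
  rw [← mul_pow]
  exact pow_le_pow_left₀ (norm_nonneg _) (h k) 2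

end SquareSummable

/-! ### Strong minimality and moment problems. -/

section StronglyMinimal

variable {H : Type*} [NormedAddCommGroup H] [InnerProductSpace ℂ H] {κ : Type*} {f : κ → H}

/-- The moment problem for a strongly minimal family is solvable for every square summable
right-hand side. -/
theorem IsStronglyMinimal.exists_inner_eq [CompleteSpace H] (hf : IsStronglyMinimal f)
    (d : κ → ℂ) (hd : Summable fun k => ‖d k‖ ^ 2) : ∃ u : H, ∀ k, inner ℂ u (f k) = d k := by
  obtain ⟨γ, hγ, hf⟩ := hf
  set D : ℝ := ∑' k, ‖d k‖ ^ 2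
  set L := Finsupp.linearCombination ℂ f
  set φ₀ := Finsupp.linearCombination ℂ d
  have hlow : ∀ c : κ →₀ ℂ, γ * ∑ k ∈ c.support, ‖c k‖ ^ 2 ≤ ‖L c‖ ^ 2 := fun c => by
    simpa [L, Finsupp.linearCombination_apply, Finsupp.sum] using hf c.support c
  have hinj : Function.Injective L := by
    rw [← LinearMap.ker_eq_bot, LinearMap.ker_eq_bot']
    intro c hc
    have h1 := hlow c
    rw [hc, norm_zero, zero_pow two_ne_zero] at h1
    have h2 : ∑ k ∈ c.support, ‖c k‖ ^ 2 ≤ 0 := by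
      by_contra h; push Not at h; nlinarith [mul_pos hγ h]
    ext k
    by_contra hk
    have h3 := Finset.single_le_sum (f := fun k => ‖c k‖ ^ 2) (fun i _ => by positivity)
      (Finsupp.mem_support_iff.2 hk)
    have h4 : 0 < ‖c k‖ ^ 2 := by
      have : 0 < ‖c k‖ := norm_pos_iff.2 hk
      positivity
    linarith [h3.trans h2]
  -- Cauchy-Schwarz with the lower bound makes `f k ↦ d k` a bounded functional on the span, which
  -- Hahn-Banach extends and Riesz represents.
  have hbound : ∀ c : κ →₀ ℂ, ‖φ₀ c‖ ≤ √(D / γ) * ‖L c‖ := fun c => by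
    have hD : 0 ≤ D := tsum_nonneg fun _ => by positivity
    rw [← abs_of_nonneg (norm_nonneg (φ₀ c)),
      ← abs_of_nonneg (by positivity : 0 ≤ √(D / γ) * ‖L c‖)]
    apply sq_le_sq.1
    rw [mul_pow, Real.sq_sqrt (by positivity)]
    have h1 : ‖φ₀ c‖ ≤ ∑ k ∈ c.support, ‖c k‖ * ‖d k‖ := by
      simpa [φ₀, Finsupp.linearCombination_apply, Finsupp.sum] using
        norm_sum_le c.support fun k => c k * d k
    calc ‖φ₀ c‖ ^ 2 ≤ (∑ k ∈ c.support, ‖c k‖ * ‖d k‖) ^ 2 := by gcongr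
      _ ≤ (∑ k ∈ c.support, ‖c k‖ ^ 2) * ∑ k ∈ c.support, ‖d k‖ ^ 2 :=
        Finset.sum_mul_sq_le_sq_mul_sq _ _ _
      _ ≤ (‖L c‖ ^ 2 / γ) * D := by
        gcongr
        · rw [le_div_iff₀ hγ, mul_comm]; exact hlow c
        · exact hd.sum_le_tsum _ fun _ _ => by positivity
      _ = D / γ * ‖L c‖ ^ 2 := by ring
  set e := LinearEquiv.ofInjective L hinj
  let φ₁ : StrongDual ℂ (LinearMap.range L) :=
    LinearMap.mkContinuous (φ₀ ∘ₗ e.symm.toLinearMap) √(D / γ) fun x => by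
      obtain ⟨c, rfl⟩ := e.surjective x
      simpa [e] using hbound c
  obtain ⟨g, hg, -⟩ := exists_extension_norm_eq (LinearMap.range L) φ₁
  refine ⟨(InnerProductSpace.toDual ℂ H).symm g, fun k => ?_⟩
  rw [InnerProductSpace.toDual_symm_apply]
  have h1 := hg (e (Finsupp.single k 1))
  have h2 : ((e (Finsupp.single k 1) : LinearMap.range L) : H) = f k := by simp [e, L]
  rw [h2] at h1
  rw [h1]
  simp [φ₁, φ₀]

/-- A family is strongly minimal if its moment problem is solvable for every square summable
right-hand side. -/
theorem isStronglyMinimal_of_forall_exists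
    (h : ∀ d : κ → ℂ, (Summable fun k => ‖d k‖ ^ 2) → ∃ u : H, ∀ k, inner ℂ u (f k) = d k) :
    IsStronglyMinimal f := by
  classical
  let w : Finset κ × (κ → ℂ) → lp (fun _ : κ => ℂ) 2 := fun p =>
    ∑ k ∈ p.1, lp.single (E := fun _ : κ => ℂ) 2 k (p.2 k)
  have hw : ∀ p, ‖w p‖ ^ 2 = ∑ k ∈ p.1, ‖p.2 k‖ ^ 2 := fun p => norm_sq_sum_single p.1 p.2
  -- The functionals on `ℓ²` are the finite coefficient vectors whose combination of the `f k` has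
  -- norm at most `1`. A solution `u` with moments `conj (d k)` bounds all of them at `d` by `‖u‖`,
  -- so these vectors are uniformly bounded in `ℓ²`.
  obtain ⟨K, hK⟩ := banach_steinhaus
    (g := fun p : {p : Finset κ × (κ → ℂ) // ‖∑ k ∈ p.1, p.2 k • f k‖ ≤ 1} =>
      innerSL ℂ (w p.1)) (fun d => by
    obtain ⟨u, hu⟩ := h (fun k => conj (d k)) (by simpa using summable_sq_norm_lp d)
    refine ⟨‖u‖, fun p => ?_⟩
    have h1 : innerSL ℂ (w p.1) d = conj (inner ℂ u (∑ k ∈ p.1.1, p.1.2 k • f k)) := by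
      rw [innerSL_apply_apply, inner_sum, map_sum, sum_inner]
      refine Finset.sum_congr rfl fun k _ => ?_
      rw [lp.inner_single_left, inner_smul_right, hu, map_mul]
      simp [mul_comm]
    rw [h1, RCLike.norm_conj]
    calc _ ≤ ‖u‖ * ‖∑ k ∈ p.1.1, p.1.2 k • f k‖ := norm_inner_le_norm _ _
      _ ≤ ‖u‖ * 1 := by gcongr; exact p.2
      _ = ‖u‖ := mul_one _)
  set K' := max K 1
  have hK' : 0 < K' := lt_of_lt_of_le one_pos (le_max_right _ _)
  -- The combination may vanish a priori, so one rescales by a larger `r` and lets `r` decrease to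
  -- the norm at the end.
  have key : ∀ (s : Finset κ) (c : κ → ℂ) (r : ℝ), ‖∑ k ∈ s, c k • f k‖ < r →
      ∑ k ∈ s, ‖c k‖ ^ 2 ≤ K' ^ 2 * r ^ 2 := by
    intro s c r hr
    have hr0 : 0 < r := (norm_nonneg _).trans_lt hr
    have h1 : ‖∑ k ∈ s, ((r⁻¹ : ℝ) * c k : ℂ) • f k‖ ≤ 1 := by
      have : ∑ k ∈ s, ((r⁻¹ : ℝ) * c k : ℂ) • f k = ((r⁻¹ : ℝ) : ℂ) • ∑ k ∈ s, c k • f k := by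
        rw [Finset.smul_sum]; simp [mul_smul]
      rw [this, norm_smul, Complex.norm_real, Real.norm_of_nonneg (by positivity), inv_mul_le_iff₀ hr0]
      linarith
    have h2 : ‖w (s, fun k => (r⁻¹ : ℝ) * c k)‖ ≤ K' := by
      have := hK ⟨(s, fun k => (r⁻¹ : ℝ) * c k), h1⟩
      simp only [innerSL_apply_norm] at this
      exact this.trans (le_max_left _ _)
    have h3 := pow_le_pow_left₀ (norm_nonneg _) h2 2
    rw [hw] at h3
    simp only [norm_mul, mul_pow, Complex.norm_real, ← Finset.mul_sum] at h3
    rw [Real.norm_of_nonneg (by positivity), inv_pow, inv_mul_le_iff₀ (by positivity)] at h3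
    linarith
  refine ⟨(K' ^ 2)⁻¹, by positivity, fun s c => ?_⟩
  rw [inv_mul_le_iff₀ (by positivity)]
  refine ge_of_tendsto (x := 𝓝[>] ‖∑ k ∈ s, c k • f k‖) (f := fun r => K' ^ 2 * r ^ 2)
    ((Continuous.tendsto (by fun_prop) _).mono_left nhdsWithin_le_nhds) ?_
  filter_upwards [self_mem_nhdsWithin] with r hr using key s c r hr

/-- Vectors in the closed span of a strongly minimal family have square summable coefficients
which compute inner products with all vectors whose moments are square summable. -/
theorem IsStronglyMinimal.exists_hasSum_inner (hf : IsStronglyMinimal f) {e : H}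
    (he : e ∈ (Submodule.span ℂ (range f)).topologicalClosure) :
    ∃ v : κ → ℂ, (Summable fun k => ‖v k‖ ^ 2) ∧ ∀ u : H,
      (Summable fun k => ‖inner ℂ u (f k)‖ ^ 2) →
      HasSum (fun k => v k * inner ℂ u (f k)) (inner ℂ u e) := by
  classical
  obtain ⟨γ, hγ, hf⟩ := hf
  let J := Finsupp.linearCombination ℂ
    (fun k => lp.single (E := fun _ : κ => ℂ) 2 k (1 : ℂ))
  set L := Finsupp.linearCombination ℂ f with hL
  have hJ : ∀ c : κ →₀ ℂ, J c = ∑ k ∈ c.support, lp.single (E := fun _ : κ => ℂ) 2 k (c k) := by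
    intro c
    simp only [J, Finsupp.linearCombination_apply, Finsupp.sum]
    refine Finset.sum_congr rfl fun k _ => ?_
    rw [← lp.single_smul]; simp
  have hlow : ∀ c : κ →₀ ℂ, √γ * ‖J c‖ ≤ ‖L c‖ := fun c => by
    have h1 := hf c.support c
    rw [← norm_sq_sum_single, ← hJ] at h1
    have h2 : ‖L c‖ = ‖∑ k ∈ c.support, c k • f k‖ := by
      simp [L, Finsupp.linearCombination_apply, Finsupp.sum]
    rw [← h2] at h1
    refine le_of_sq_le_sq ?_ (norm_nonneg _)
    rw [mul_pow, Real.sq_sqrt hγ.le]; exact h1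
  rw [← SetLike.mem_coe, Submodule.topologicalClosure_coe, mem_closure_iff_seq_limit] at he
  obtain ⟨x, hx, hxe⟩ := he
  have hx' : ∀ n, ∃ c : κ →₀ ℂ, L c = x n := fun n => by
    have := hx n
    rw [SetLike.mem_coe, ← Finsupp.range_linearCombination] at this
    exact this
  choose c hc using hx'
  -- The lower bound makes coefficients of a convergent sequence of combinations Cauchy in `ℓ²`.
  -- With no upper bound, `∑ v k • f k` need not converge, so the limit `v` is only tested against
  -- `u` with square summable moments.
  have hcauchy : CauchySeq fun n => J (c n) := by
    have h0 : 0 < √γ := Real.sqrt_pos.2 hγ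
    rw [Metric.cauchySeq_iff]
    intro ε hε
    obtain ⟨N, hN⟩ := Metric.cauchySeq_iff.1 hxe.cauchySeq (√γ * ε) (by positivity)
    refine ⟨N, fun m hm n hn => ?_⟩
    have h1 := hN m hm n hn
    have h2 := hlow (c m - c n)
    rw [dist_eq_norm] at h1 ⊢
    rw [map_sub, map_sub, hc, hc] at h2
    exact lt_of_mul_lt_mul_left (h2.trans_lt h1) h0.le
  obtain ⟨v, hv⟩ := cauchySeq_tendsto_of_complete hcauchy
  refine ⟨v, summable_sq_norm_lp v, fun u hu => ?_⟩
  let d : lp (fun _ : κ => ℂ) 2 := ⟨fun k => conj (inner ℂ u (f k)),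
    memℓp_two_of_summable (by simpa only [RCLike.norm_conj] using hu)⟩
  have hd : ∀ n, inner ℂ d (J (c n)) = inner ℂ u (x n) := fun n => by
    rw [← hc, hJ, hL, Finsupp.linearCombination_apply, Finsupp.sum, inner_sum, inner_sum]
    refine Finset.sum_congr rfl fun k _ => ?_
    rw [lp.inner_single_right, inner_smul_right]
    simp [d]
  have h1 : inner ℂ d v = inner ℂ u e := by
    refine tendsto_nhds_unique ((tendsto_const_nhds (x := d)).inner (𝕜 := ℂ) hv) ?_
    simp_rw [hd]
    exact tendsto_const_nhds.inner hxe
  rw [← h1]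
  have := lp.hasSum_inner (𝕜 := ℂ) d v
  simpa [d] using this

end StronglyMinimal

/-! ### Coordinates in a Riesz basis. -/

section RieszBasis

variable {X : Type*} [NormedAddCommGroup X] [InnerProductSpace ℂ X] {ι : Type*} {φ ψ : ι → X}

lemma inner_sum_smul_of_biorthogonal [DecidableEq ι]
    (hbio : ∀ i j, inner ℂ (ψ j) (φ i) = if i = j then (1 : ℂ) else 0)
    (s : Finset ι) (c : ι → ℂ) (j : ι) :
    inner ℂ (ψ j) (∑ i ∈ s, c i • φ i) = if j ∈ s then c j else 0 := by
  rw [inner_sum]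
  simp [inner_smul_right, hbio]

/-- On the span of `φ` the inner products with `ψ` are the coefficients, so this is the lower Riesz
bound; both sides are continuous and the span is dense. -/
lemma IsRieszBasis.bessel [DecidableEq ι] (hφ : IsRieszBasis φ)
    (hbio : ∀ i j, inner ℂ (ψ j) (φ i) = if i = j then (1 : ℂ) else 0) :
    ∃ C > 0, ∀ (s : Finset ι) (x : X), ∑ j ∈ s, ‖inner ℂ (ψ j) x‖ ^ 2 ≤ C * ‖x‖ ^ 2 := by
  obtain ⟨hdense, m, M, hm, hM, h⟩ := hφ
  refine ⟨m⁻¹, by positivity, fun s x => ?_⟩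
  have hx : x ∈ closure (Submodule.span ℂ (range φ) : Set X) := by
    rw [← Submodule.topologicalClosure_coe, hdense]; trivial
  refine closure_minimal (t := {x | ∑ j ∈ s, ‖inner ℂ (ψ j) x‖ ^ 2 ≤ m⁻¹ * ‖x‖ ^ 2}) ?_
    (isClosed_le (by fun_prop) (by fun_prop)) hx
  intro y hy
  rw [SetLike.mem_coe, ← Finsupp.range_linearCombination] at hy
  obtain ⟨c, rfl⟩ := hy
  rw [mem_ofPred_eq, Finsupp.linearCombination_apply, Finsupp.sum]
  have h1 := (h c.support c).1
  rw [← le_inv_mul_iff₀ hm] at h1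
  refine le_trans ?_ h1
  simp_rw [inner_sum_smul_of_biorthogonal hbio]
  calc ∑ j ∈ s, ‖if j ∈ c.support then c j else 0‖ ^ 2
      = ∑ j ∈ s with j ∈ c.support, ‖c j‖ ^ 2 := by
        rw [Finset.sum_filter]
        exact Finset.sum_congr rfl fun j _ => by split_ifs <;> simp
    _ ≤ ∑ j ∈ c.support, ‖c j‖ ^ 2 :=
        Finset.sum_le_sum_of_subset_of_nonneg (by intro j; simp) fun _ _ _ => by positivity

lemma IsRieszBasis.summable_sq_inner [DecidableEq ι] (hφ : IsRieszBasis φ)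
    (hbio : ∀ i j, inner ℂ (ψ j) (φ i) = if i = j then (1 : ℂ) else 0) (x : X) :
    Summable fun j => ‖inner ℂ (ψ j) x‖ ^ 2 := by
  obtain ⟨C, -, hC⟩ := hφ.bessel hbio
  exact summable_of_sum_le (fun _ => by positivity) fun s => hC s x

/-- Approximate `x` by `y n` in the span. The coefficients of `y n` are also those of `y n - x`, so
the upper Riesz bound and Bessel give `‖y n‖² ≤ M C ‖y n - x‖² → 0`. -/
lemma IsRieszBasis.eq_zero_of_inner [DecidableEq ι] (hφ : IsRieszBasis φ)
    (hbio : ∀ i j, inner ℂ (ψ j) (φ i) = if i = j then (1 : ℂ) else 0) {x : X}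
    (hx : ∀ j, inner ℂ (ψ j) x = 0) : x = 0 := by
  obtain ⟨C, hC0, hC⟩ := hφ.bessel hbio
  obtain ⟨hdense, m, M, hm, hM, h⟩ := hφ
  have hx' : x ∈ closure (Submodule.span ℂ (range φ) : Set X) := by
    rw [← Submodule.topologicalClosure_coe, hdense]; trivial
  rw [mem_closure_iff_seq_limit] at hx'
  obtain ⟨y, hy, hyx⟩ := hx'
  have hle : ∀ n, ‖y n‖ ^ 2 ≤ M * (C * ‖y n - x‖ ^ 2) := fun n => by
    have hyn := hy n
    rw [SetLike.mem_coe, ← Finsupp.range_linearCombination] at hyn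
    obtain ⟨c, hc⟩ := hyn
    rw [Finsupp.linearCombination_apply, Finsupp.sum] at hc
    rw [← hc]
    refine (h c.support c).2.trans ?_
    gcongr
    refine le_trans (le_of_eq ?_) (hC c.support (∑ k ∈ c.support, c k • φ k - x))
    refine Finset.sum_congr rfl fun j hj => ?_
    rw [inner_sub_right, hx, sub_zero, inner_sum_smul_of_biorthogonal hbio, if_pos hj]
  have h1 : Tendsto (fun n => ‖y n‖ ^ 2) atTop (𝓝 (‖x‖ ^ 2)) := hyx.norm.pow 2
  have h2 : Tendsto (fun n => M * (C * ‖y n - x‖ ^ 2)) atTop (𝓝 (M * (C * ‖x - x‖ ^ 2))) :=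
    (((hyx.sub_const x).norm.pow 2).const_mul C).const_mul M
  have h3 := le_of_tendsto_of_tendsto' h1 h2 hle
  have h4 : ‖x‖ ^ 2 ≤ 0 := by simpa using h3
  exact norm_eq_zero.1 (pow_eq_zero_iff two_ne_zero |>.1 (le_antisymm h4 (by positivity)))

lemma IsRieszBasis.exists_inner_eq [CompleteSpace X] [DecidableEq ι] (hφ : IsRieszBasis φ)
    (hbio : ∀ i j, inner ℂ (ψ j) (φ i) = if i = j then (1 : ℂ) else 0) {d : ι → ℂ}
    (hd : Summable fun j => ‖d j‖ ^ 2) : ∃ x : X, ∀ j, inner ℂ (ψ j) x = d j := by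
  obtain ⟨hdense, m, M, hm, hM, h⟩ := hφ
  have hsum : Summable fun j => d j • φ j := by
    rw [summable_iff_vanishing_norm]
    intro ε hε
    obtain ⟨s, hs⟩ := summable_iff_vanishing_norm.1 hd (ε ^ 2 / M) (by positivity)
    refine ⟨s, fun t ht => ?_⟩
    have h1 := hs t ht
    rw [Real.norm_of_nonneg (Finset.sum_nonneg fun _ _ => by positivity), lt_div_iff₀ hM] at h1
    exact lt_of_pow_lt_pow_left₀ 2 hε.le (by linarith [(h t d).2])
  refine ⟨∑' i, d i • φ i, fun j => ?_⟩
  have h1 := hsum.hasSum.mapL (innerSL ℂ (ψ j))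
  have h2 : HasSum (fun i => innerSL ℂ (ψ j) (d i • φ i)) (d j) := by
    convert hasSum_ite_eq j (d j) using 2 with i
    rw [innerSL_apply_apply, inner_smul_right, hbio]
    split_ifs with hij <;> simp [hij]
  exact h1.unique h2

end RieszBasis

/-! ### Complex-valued absolutely continuous functions, through real and imaginary parts. -/

section AbsolutelyContinuous

variable {f g : ℝ → ℂ} {a b : ℝ}

lemma absolutelyContinuousOnInterval_of_dist_le {X Y : Type*} [PseudoMetricSpace X]
    [PseudoMetricSpace Y] {f : ℝ → X} {g : ℝ → Y} (hf : AbsolutelyContinuousOnInterval f a b)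
    (h : ∀ s t, dist (g s) (g t) ≤ dist (f s) (f t)) : AbsolutelyContinuousOnInterval g a b := by
  rw [absolutelyContinuousOnInterval_iff] at hf ⊢
  intro ε hε
  obtain ⟨δ, hδ, H⟩ := hf ε hε
  exact ⟨δ, hδ, fun E hE hlt => (Finset.sum_le_sum fun i _ => h _ _).trans_lt (H E hE hlt)⟩

lemma absolutelyContinuousOnInterval_re (hf : AbsolutelyContinuousOnInterval f a b) :
    AbsolutelyContinuousOnInterval (fun t => (f t).re) a b :=
  absolutelyContinuousOnInterval_of_dist_le hf fun s t => by
    rw [Real.dist_eq, Complex.dist_eq, ← Complex.sub_re]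
    exact Complex.abs_re_le_norm _

lemma absolutelyContinuousOnInterval_im (hf : AbsolutelyContinuousOnInterval f a b) :
    AbsolutelyContinuousOnInterval (fun t => (f t).im) a b :=
  absolutelyContinuousOnInterval_of_dist_le hf fun s t => by
    rw [Real.dist_eq, Complex.dist_eq, ← Complex.sub_im]
    exact Complex.abs_im_le_norm _

lemma absolutelyContinuousOnInterval_ofReal {f : ℝ → ℝ}
    (hf : AbsolutelyContinuousOnInterval f a b) :
    AbsolutelyContinuousOnInterval (fun t => (f t : ℂ)) a b :=
  absolutelyContinuousOnInterval_of_dist_le hf fun s t => by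
    rw [Complex.dist_eq, ← Complex.ofReal_sub, Complex.norm_real, Real.dist_eq, Real.norm_eq_abs]

lemma ae_hasDerivAt_complex (hf : AbsolutelyContinuousOnInterval f a b) :
    ∀ᵐ t : ℝ, t ∈ uIcc a b → HasDerivAt f
      (deriv (fun t => (f t).re) t + deriv (fun t => (f t).im) t * Complex.I) t := by
  filter_upwards [(absolutelyContinuousOnInterval_re hf).ae_differentiableAt,
    (absolutelyContinuousOnInterval_im hf).ae_differentiableAt] with t h1 h2 ht
  have := (h1 ht).hasDerivAt.ofReal_comp.add ((h2 ht).hasDerivAt.ofReal_comp.mul_const Complex.I)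
  refine this.congr_of_eventuallyEq (Eventually.of_forall fun s => ?_)
  simp [Complex.re_add_im]

lemma ae_deriv_eq_complex (hf : AbsolutelyContinuousOnInterval f a b) :
    ∀ᵐ t : ℝ, t ∈ uIoc a b → deriv f t =
      deriv (fun t => (f t).re) t + deriv (fun t => (f t).im) t * Complex.I := by
  filter_upwards [ae_hasDerivAt_complex hf] with t ht ht'
  exact (ht (uIoc_subset_uIcc ht')).deriv

lemma intervalIntegrable_ofReal {f : ℝ → ℝ} (hf : IntervalIntegrable f volume a b) :
    IntervalIntegrable (fun t => (f t : ℂ)) volume a b :=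
  ⟨hf.1.ofReal, hf.2.ofReal⟩

lemma intervalIntegrable_deriv_complex (hf : AbsolutelyContinuousOnInterval f a b) :
    IntervalIntegrable (deriv f) volume a b := by
  have h1 := intervalIntegrable_ofReal (absolutelyContinuousOnInterval_re hf).intervalIntegrable_deriv
  have h2 := intervalIntegrable_ofReal (absolutelyContinuousOnInterval_im hf).intervalIntegrable_deriv
  refine (h1.add (h2.mul_const Complex.I)).congr_ae ?_
  rw [EventuallyEq, ae_restrict_iff' measurableSet_uIoc]
  filter_upwards [ae_deriv_eq_complex hf] with t ht ht'
  exact (ht ht').symm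

lemma integral_deriv_eq_sub_complex (hf : AbsolutelyContinuousOnInterval f a b) :
    ∫ t in a..b, deriv f t = f b - f a := by
  have hre := absolutelyContinuousOnInterval_re hf
  have him := absolutelyContinuousOnInterval_im hf
  rw [intervalIntegral.integral_congr_ae (ae_deriv_eq_complex hf),
    intervalIntegral.integral_add (intervalIntegrable_ofReal hre.intervalIntegrable_deriv)
      ((intervalIntegrable_ofReal him.intervalIntegrable_deriv).mul_const _), intervalIntegral.integral_mul_const,
    intervalIntegral.integral_ofReal, intervalIntegral.integral_ofReal,
    hre.integral_deriv_eq_sub, him.integral_deriv_eq_sub]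
  apply Complex.ext <;> simp

lemma absolutelyContinuousOnInterval_integral_complex {c : ℝ}
    (h : IntervalIntegrable f volume a b) (hc : c ∈ uIcc a b) :
    AbsolutelyContinuousOnInterval (fun t => ∫ s in c..t, f s) a b := by
  have hre : IntervalIntegrable (fun t => (f t).re) volume a b := ⟨h.1.re, h.2.re⟩
  have him : IntervalIntegrable (fun t => (f t).im) volume a b := ⟨h.1.im, h.2.im⟩
  have h1 := absolutelyContinuousOnInterval_ofReal
    (hre.absolutelyContinuousOnInterval_intervalIntegral hc)
  have h2 := absolutelyContinuousOnInterval_ofReal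
    (him.absolutelyContinuousOnInterval_intervalIntegral hc)
  have h3 := h1.add (h2.const_smul Complex.I)
  rw [absolutelyContinuousOnInterval_iff] at h3 ⊢
  have heq : ∀ t ∈ uIcc a b, (∫ s in c..t, f s) =
      ((fun t => ((∫ s in c..t, (f s).re : ℝ) : ℂ)) +
        fun t => Complex.I • ((∫ s in c..t, (f s).im : ℝ) : ℂ)) t := by
    intro t ht
    have hsub : IntervalIntegrable f volume c t :=
      h.mono_set (uIcc_subset_uIcc hc ht)
    simp only [Pi.add_apply, smul_eq_mul]
    rw [← intervalIntegral.integral_ofReal, ← intervalIntegral.integral_ofReal,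
      ← intervalIntegral.integral_const_mul, ← intervalIntegral.integral_add]
    · exact intervalIntegral.integral_congr fun s _ => by simp [mul_comm Complex.I, Complex.re_add_im]
    · exact intervalIntegrable_ofReal ⟨hsub.1.re, hsub.2.re⟩
    · exact (intervalIntegrable_ofReal ⟨hsub.1.im, hsub.2.im⟩).const_mul _
  intro ε hε
  obtain ⟨δ, hδ, H⟩ := h3 ε hε
  refine ⟨δ, hδ, fun E hE hlt => ?_⟩
  refine (Finset.sum_congr rfl fun i hi => ?_).trans_lt (H E hE hlt)
  have := hE.1 i (by simpa using hi)
  rw [heq _ this.1, heq _ this.2]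

/-- Integration by parts against a differentiable function with continuous derivative. -/
lemma integral_mul_deriv_add_integral_mul (hf : AbsolutelyContinuousOnInterval f a b)
    {g' : ℝ → ℂ} (hg : ∀ t, HasDerivAt g (g' t) t) (hg' : Continuous g') :
    (∫ t in a..b, g t * deriv f t) + ∫ t in a..b, g' t * f t = g b * f b - g a * f a := by
  have hg1 : ContDiff ℝ 1 g := by
    rw [contDiff_one_iff_deriv]
    refine ⟨fun t => (hg t).differentiableAt, ?_⟩
    rwa [show deriv g = g' from funext fun t => (hg t).deriv]
  have hgac : AbsolutelyContinuousOnInterval g a b := hg1.contDiffOn.absolutelyContinuousOnInterval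
  have h1 := integral_deriv_eq_sub_complex (hgac.smul hf)
  simp only [Pi.smul_apply', smul_eq_mul] at h1
  have h4 : IntervalIntegrable (fun t => g' t * f t) volume a b :=
    (hg'.continuousOn.mul hf.continuousOn).intervalIntegrable
  rw [← h1, ← intervalIntegral.integral_add
    ((intervalIntegrable_deriv_complex hf).continuousOn_mul hgac.continuousOn) h4]
  apply intervalIntegral.integral_congr_ae
  filter_upwards [ae_hasDerivAt_complex hf] with t ht ht'
  have h2 := ht (uIoc_subset_uIcc ht')
  have h3 := (hg t).mul h2.differentiableAt.hasDerivAt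
  rw [h3.deriv, add_comm]

end AbsolutelyContinuous

/-! ### Controls in `H¹` and their derivatives. -/

section Controls

variable {T : ℝ}

lemma hasDerivAt_cexp_neg_mul (z : ℂ) (t : ℝ) :
    HasDerivAt (fun t : ℝ => Complex.exp (-z * t)) (-z * Complex.exp (-z * t)) t := by
  have h1 : HasDerivAt (fun t : ℝ => -z * (t : ℂ)) (-z) t := by
    simpa using (HasDerivAt.ofReal_comp (hasDerivAt_id t)).const_mul (-z)
  simpa [mul_comm] using h1.cexp

lemma MemH1.mul_integral_exp {a : ℂ} {v : ℝ → ℂ} (hv : MemH1 T a 0 v) (z : ℂ) :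
    z * ∫ t in (0 : ℝ)..T, Complex.exp (-z * t) * v t =
      a + ∫ t in (0 : ℝ)..T, Complex.exp (-z * t) * deriv v t := by
  obtain ⟨hac, -, h0, hT⟩ := hv
  have h1 := integral_mul_deriv_add_integral_mul hac (hasDerivAt_cexp_neg_mul z) (by fun_prop)
  simp only [mul_assoc, h0, hT, intervalIntegral.integral_const_mul] at h1
  simp at h1 ⊢
  linear_combination -h1

lemma MemH1.integral_eq {a : ℂ} {v : ℝ → ℂ} (hv : MemH1 T a 0 v) :
    ∫ t in (0 : ℝ)..T, v t = -∫ t in (0 : ℝ)..T, t * deriv v t := by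
  obtain ⟨hac, -, h0, hT⟩ := hv
  have h1 := integral_mul_deriv_add_integral_mul hac (g := fun t : ℝ => (t : ℂ)) (g' := fun _ => 1)
    (fun t => (hasDerivAt_id t).ofReal_comp) (by fun_prop)
  simp [hT] at h1
  linear_combination h1

lemma intervalIntegrable_of_memLp_two (hT : 0 ≤ T) {u : ℝ → ℂ}
    (hu : MemLp u 2 (volume.restrict (Icc 0 T))) : IntervalIntegrable u volume 0 T := by
  rw [intervalIntegrable_iff_integrableOn_Icc_of_le hT]
  exact hu.integrable (by norm_num)

lemma ae_hasDerivAt_primitive (hT : 0 ≤ T) {u : ℝ → ℂ} (hu : IntervalIntegrable u volume 0 T)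
    (a : ℂ) : ∀ᵐ t ∂(volume.restrict (Icc 0 T)),
      HasDerivAt (fun t => a + ∫ s in (0 : ℝ)..t, u s) (u t) t := by
  rw [ae_restrict_iff' measurableSet_Icc]
  filter_upwards [hu.ae_hasDerivAt_integral] with t ht ht'
  rw [uIcc_of_le hT] at ht
  exact (ht ht' 0 (left_mem_Icc.2 hT)).const_add a

/-- The primitive of `u` starting at `a`; the moment of `u` against `1` is what makes it vanish at
`T`. -/
lemma exists_memH1 (hT : 0 ≤ T) {u : ℝ → ℂ} (hu : MemLp u 2 (volume.restrict (Icc 0 T))) {a : ℂ}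
    (ha : ∫ t in (0 : ℝ)..T, u t = -a) :
    ∃ v : ℝ → ℂ, MemH1 T a 0 v ∧ deriv v =ᵐ[volume.restrict (Icc 0 T)] u := by
  have hint := intervalIntegrable_of_memLp_two hT hu
  have hae : deriv (fun t => a + ∫ s in (0 : ℝ)..t, u s) =ᵐ[volume.restrict (Icc 0 T)] u := by
    filter_upwards [ae_hasDerivAt_primitive hT hint a] with t ht using ht.deriv
  refine ⟨fun t => a + ∫ s in (0 : ℝ)..t, u s, ⟨?_, ?_, by simp, by simp [ha]⟩, hae⟩
  · exact absolutelyContinuousOnInterval_of_dist_le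
      (absolutelyContinuousOnInterval_integral_complex hint left_mem_uIcc) fun s t => by simp
  · exact (memLp_congr_ae hae).2 hu

end Controls

/-! ### The finite Laplace transform. -/

section Transform

variable {T : ℝ}

/-- The exponential `t ↦ e^{-zt}` in `L²[0, T]`. -/
noncomputable def expL2 (T : ℝ) (z : ℂ) : Lp ℂ 2 (volume.restrict (Icc (0 : ℝ) T)) :=
  toL2 T (fun t => Complex.exp (-z * t)) (by fun_prop)

/-- The finite Laplace transform `z ↦ ∫₀ᵀ e^{-zt} conj (u t) dt` of (the conjugate of) `u`. -/
noncomputable def laplace (u : Lp ℂ 2 (volume.restrict (Icc (0 : ℝ) T))) (z : ℂ) : ℂ :=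
  inner ℂ u (expL2 T z)

lemma inner_toL2 (u : Lp ℂ 2 (volume.restrict (Icc (0 : ℝ) T))) (f : ℝ → ℂ) (hf : Continuous f) :
    inner ℂ u (toL2 T f hf) = ∫ t in Icc 0 T, f t * conj (u t) := by
  rw [L2.inner_def]
  refine integral_congr_ae ?_
  filter_upwards [MemLp.coeFn_toLp ((memLp_two_iff_integrable_sq_norm hf.aestronglyMeasurable).2
    ((hf.norm.pow 2).continuousOn.integrableOn_compact (isCompact_Icc (a := (0 : ℝ)) (b := T))))]
    with t ht
  rw [RCLike.inner_apply, toL2, ht]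

lemma inner_toL2_interval (hT : 0 ≤ T) (u : Lp ℂ 2 (volume.restrict (Icc (0 : ℝ) T)))
    (f : ℝ → ℂ) (hf : Continuous f) :
    inner ℂ u (toL2 T f hf) = ∫ t in (0 : ℝ)..T, f t * conj (u t) := by
  rw [inner_toL2, intervalIntegral.integral_of_le hT, integral_Icc_eq_integral_Ioc]

lemma memLp_conj {u : ℝ → ℂ} (hu : MemLp u 2 (volume.restrict (Icc 0 T))) :
    MemLp (fun t => conj (u t)) 2 (volume.restrict (Icc 0 T)) :=
  hu.star

lemma integrable_conj_coeFn (u : Lp ℂ 2 (volume.restrict (Icc (0 : ℝ) T))) :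
    Integrable (fun t => conj (u t)) (volume.restrict (Icc 0 T)) :=
  (memLp_conj (Lp.memLp u)).integrable (by norm_num)

lemma laplace_eq (u : Lp ℂ 2 (volume.restrict (Icc (0 : ℝ) T))) (z : ℂ) :
    laplace u z = ∫ t in Icc 0 T, Complex.exp (-z * t) * conj (u t) :=
  inner_toL2 u _ _

lemma norm_cexp_neg_mul_le {z : ℂ} {t : ℝ} (ht : t ∈ Icc 0 T) :
    ‖Complex.exp (-z * t)‖ ≤ Real.exp (T * ‖z‖) := by
  rw [Complex.norm_exp]
  gcongr
  calc (-z * t).re ≤ ‖-z * (t : ℂ)‖ := Complex.re_le_norm _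
    _ = t * ‖z‖ := by
      rw [norm_mul, norm_neg, Complex.norm_real, Real.norm_of_nonneg ht.1, mul_comm]
    _ ≤ T * ‖z‖ := by gcongr; exact ht.2

lemma exists_norm_laplace_le (u : Lp ℂ 2 (volume.restrict (Icc (0 : ℝ) T))) :
    ∃ C ≥ 0, ∀ z, ‖laplace u z‖ ≤ C * Real.exp (T * ‖z‖) := by
  refine ⟨∫ t in Icc 0 T, ‖conj (u t)‖, by positivity, fun z => ?_⟩
  rw [laplace_eq, ← integral_mul_const]
  refine norm_integral_le_of_norm_le ((integrable_conj_coeFn u).norm.mul_const _) ?_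
  rw [ae_restrict_iff' measurableSet_Icc]
  refine Eventually.of_forall fun t ht => ?_
  rw [norm_mul, mul_comm]
  gcongr
  exact norm_cexp_neg_mul_le ht

/-- Dominated convergence, since `e^{-xt} → 0` for `t > 0`. It ensures that `1 - laplace u` is not
identically zero. -/
lemma tendsto_laplace_atTop (u : Lp ℂ 2 (volume.restrict (Icc (0 : ℝ) T))) :
    Tendsto (fun x : ℝ => laplace u x) atTop (𝓝 0) := by
  simp_rw [laplace_eq]
  rw [show (0 : ℂ) = ∫ t in Icc 0 T, (0 : ℂ) by simp]
  refine tendsto_integral_filter_of_dominated_convergence (fun t => ‖conj (u t)‖)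
    (Eventually.of_forall fun x => ?_) ?_ (integrable_conj_coeFn u).norm ?_
  · exact (Continuous.aestronglyMeasurable (by fun_prop)).mul
      (integrable_conj_coeFn u).aestronglyMeasurable
  · filter_upwards [eventually_ge_atTop 0] with x hx
    rw [ae_restrict_iff' measurableSet_Icc]
    refine Eventually.of_forall fun t ht => ?_
    rw [norm_mul, Complex.norm_exp]
    refine mul_le_of_le_one_left (norm_nonneg _) (Real.exp_le_one_iff.2 ?_)
    simpa using mul_nonneg hx ht.1
  · rw [ae_restrict_iff' measurableSet_Icc]
    filter_upwards [compl_mem_ae_iff.2 (measure_singleton (0 : ℝ))] with t ht0 ht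
    have htpos : 0 < t := lt_of_le_of_ne ht.1 (Ne.symm ht0)
    rw [← zero_mul (conj (u t))]
    refine Tendsto.mul_const _ ?_
    rw [tendsto_zero_iff_norm_tendsto_zero]
    have : ∀ x : ℝ, ‖Complex.exp (-(x : ℂ) * t)‖ = Real.exp (-(t * x)) := fun x => by
      rw [Complex.norm_exp]; simp [mul_comm]
    simp_rw [this]
    exact Real.tendsto_exp_neg_atTop_nhds_zero.comp (tendsto_id.const_mul_atTop htpos)

lemma hasDerivAt_laplace (u : Lp ℂ 2 (volume.restrict (Icc (0 : ℝ) T))) (z : ℂ) :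
    HasDerivAt (laplace u)
      (∫ t in Icc 0 T, -(t : ℂ) * Complex.exp (-z * t) * conj (u t)) z := by
  have hint := integrable_conj_coeFn u
  have hlap : laplace u = fun z => ∫ t in Icc 0 T, Complex.exp (-z * t) * conj (u t) :=
    funext (laplace_eq u)
  rw [hlap]
  refine (hasDerivAt_integral_of_dominated_loc_of_deriv_le
    (F := fun (z : ℂ) (t : ℝ) => Complex.exp (-z * t) * conj (u t))
    (F' := fun (z : ℂ) (t : ℝ) => -(t : ℂ) * Complex.exp (-z * t) * conj (u t))
    (bound := fun t => T * Real.exp (T * (‖z‖ + 1)) * ‖conj (u t)‖)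
    (Metric.ball_mem_nhds z one_pos) (Eventually.of_forall fun x => ?_) ?_ ?_ ?_
    (hint.norm.const_mul _) ?_).2
  · exact (Continuous.aestronglyMeasurable (by fun_prop)).mul hint.aestronglyMeasurable
  · refine (hint.norm.const_mul (Real.exp (T * ‖z‖))).mono'
      ((Continuous.aestronglyMeasurable (by fun_prop)).mul hint.aestronglyMeasurable) ?_
    rw [ae_restrict_iff' measurableSet_Icc]
    refine Eventually.of_forall fun t ht => ?_
    rw [norm_mul]
    gcongr
    exact norm_cexp_neg_mul_le ht
  · exact (Continuous.aestronglyMeasurable (by fun_prop)).mul hint.aestronglyMeasurable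
  · rw [ae_restrict_iff' measurableSet_Icc]
    refine Eventually.of_forall fun t ht x hx => ?_
    have hT : 0 ≤ T := ht.1.trans ht.2
    have hx' : ‖x‖ ≤ ‖z‖ + 1 := by
      have h1 := norm_le_insert' x z
      rw [Metric.mem_ball, dist_eq_norm] at hx
      linarith
    rw [norm_mul, norm_mul, norm_neg, Complex.norm_real, Real.norm_of_nonneg ht.1]
    gcongr
    · exact ht.2
    · exact (norm_cexp_neg_mul_le ht).trans (by gcongr)
  · refine Eventually.of_forall fun t x _ => ?_
    have h1 : HasDerivAt (fun z : ℂ => -z * (t : ℂ)) (-(t : ℂ)) x := by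
      simpa using (hasDerivAt_id x).neg.mul_const (t : ℂ)
    simpa [mul_comm] using h1.cexp.mul_const (conj (u t))

lemma differentiable_laplace (u : Lp ℂ 2 (volume.restrict (Icc (0 : ℝ) T))) :
    Differentiable ℂ (laplace u) :=
  fun z => (hasDerivAt_laplace u z).differentiableAt

lemma hasDerivAt_laplace_zero (u : Lp ℂ 2 (volume.restrict (Icc (0 : ℝ) T))) :
    HasDerivAt (laplace u)
      (-inner ℂ u (toL2 T (fun t => (t : ℂ)) Complex.continuous_ofReal)) 0 := by
  convert hasDerivAt_laplace u 0 using 1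
  rw [inner_toL2, ← integral_neg]
  simp

/-- Difference quotients of finite Laplace transforms are again finite Laplace transforms. -/
lemma exists_laplace_div (hT : 0 ≤ T) (u : Lp ℂ 2 (volume.restrict (Icc (0 : ℝ) T))) (μ : ℂ) :
    ∃ w : Lp ℂ 2 (volume.restrict (Icc (0 : ℝ) T)),
      ∀ z, (z - μ) * laplace w z = laplace u μ - laplace u z := by
  have hlap : ∀ (u : Lp ℂ 2 (volume.restrict (Icc (0 : ℝ) T))) z,
      laplace u z = ∫ t in (0 : ℝ)..T, Complex.exp (-z * t) * conj (u t) :=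
    fun u z => inner_toL2_interval hT u _ _
  have hk : MemLp (fun t : ℝ => -(Complex.exp (-μ * t) * conj (u t))) 2
      (volume.restrict (Icc 0 T)) := by
    refine MemLp.neg ?_
    refine (memLp_conj (Lp.memLp u)).of_le_mul (c := Real.exp (T * ‖μ‖))
      ((Continuous.aestronglyMeasurable (by fun_prop)).mul
        (integrable_conj_coeFn u).aestronglyMeasurable) ?_
    rw [ae_restrict_iff' measurableSet_Icc]
    refine Eventually.of_forall fun t ht => ?_
    rw [norm_mul]
    gcongr
    exact norm_cexp_neg_mul_le ht
  -- Here `v(t) = laplace u μ - ∫₀ᵗ e^{-μs} conj (u s) ds` vanishes at `T`. Integrating `e^{-(z-μ)t}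
  -- v(t)` by parts gives the quotient, so `w` is the conjugate of `e^{μt} v(t)`.
  obtain ⟨v, hv, hv'⟩ := exists_memH1 hT hk (a := laplace u μ)
    (by rw [intervalIntegral.integral_neg, ← hlap])
  have hvc : ContinuousOn v (Icc 0 T) := by
    have := hv.1.continuousOn
    rwa [uIcc_of_le hT] at this
  have hwc : ContinuousOn (fun t : ℝ => conj (Complex.exp (μ * t) * v t)) (Icc 0 T) :=
    Complex.continuous_conj.comp_continuousOn ((Continuous.continuousOn (by fun_prop)).mul hvc)
  have hw : MemLp (fun t : ℝ => conj (Complex.exp (μ * t) * v t)) 2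
      (volume.restrict (Icc 0 T)) :=
    (memLp_two_iff_integrable_sq_norm (hwc.aestronglyMeasurable measurableSet_Icc)).2
      ((hwc.norm.pow 2).integrableOn_compact isCompact_Icc)
  refine ⟨hw.toLp, fun z => ?_⟩
  have h1 := hv.mul_integral_exp (z - μ)
  have h2 : laplace (hw.toLp) z = ∫ t in (0 : ℝ)..T, Complex.exp (-(z - μ) * t) * v t := by
    rw [laplace_eq, intervalIntegral.integral_of_le hT, ← integral_Icc_eq_integral_Ioc]
    refine integral_congr_ae ?_
    filter_upwards [hw.coeFn_toLp] with t ht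
    rw [ht, Complex.conj_conj, ← mul_assoc, ← Complex.exp_add]
    ring_nf
  have h3 : ∫ t in (0 : ℝ)..T, Complex.exp (-(z - μ) * t) * deriv v t = -laplace u z := by
    rw [laplace_eq, intervalIntegral.integral_of_le hT, ← integral_Icc_eq_integral_Ioc,
      ← integral_neg]
    refine integral_congr_ae ?_
    filter_upwards [hv'] with t ht
    rw [ht, mul_neg, ← mul_assoc, ← Complex.exp_add]
    ring_nf
  rw [h2, h1, h3, sub_eq_add_neg]

end Transform

/-! ### Zeros of functions of exponential type and a Liouville argument. -/

section EntireFunctions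

lemma norm_le_of_norm_le_sphere {G : ℂ → ℂ} (hG : Differentiable ℂ G) {c : ℂ} {r C : ℝ}
    (hr : 0 < r) (h : ∀ z, ‖z - c‖ = r → ‖G z‖ ≤ C) {z : ℂ} (hz : ‖z - c‖ ≤ r) : ‖G z‖ ≤ C := by
  refine Complex.norm_le_of_forall_mem_frontier_norm_le (U := Metric.ball c r)
    Metric.isBounded_ball hG.diffContOnCl (fun w hw => h w ?_) ?_
  · rw [frontier_ball c hr.ne'] at hw
    simpa [dist_eq_norm] using hw
  · rw [closure_ball c hr.ne']
    simpa [dist_eq_norm] using hz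

lemma exists_eq_prod_mul {G : ℂ → ℂ} (hG : Differentiable ℂ G) (F : Finset ℂ)
    (hF : ∀ a ∈ F, G a = 0) :
    ∃ H : ℂ → ℂ, Differentiable ℂ H ∧ ∀ z, G z = (∏ a ∈ F, (z - a)) * H z := by
  classical
  induction F using Finset.induction_on with
  | empty => exact ⟨G, hG, fun z => by simp⟩
  | insert a F ha ih =>
    obtain ⟨H, hH, hGH⟩ := ih fun b hb => hF b (Finset.mem_insert_of_mem hb)
    have h0 : H a = 0 := by
      have h1 := hF a (Finset.mem_insert_self _ _)
      rw [hGH, mul_eq_zero, Finset.prod_eq_zero_iff] at h1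
      refine h1.resolve_left ?_
      rintro ⟨b, hb, hab⟩
      exact ha (by rwa [sub_eq_zero.1 hab])
    refine ⟨dslope H a, ?_, fun z => ?_⟩
    · rw [← differentiableOn_univ] at hH ⊢
      exact (Complex.differentiableOn_dslope univ_mem).2 hH
    · have h1 := sub_smul_dslope H a z
      rw [h0, sub_zero, smul_eq_mul] at h1
      rw [Finset.prod_insert ha, hGH, ← h1]
      ring

/-- A function of exponential type has at most linearly many zeros in large discs. -/
lemma two_pow_card_zeros_mul_le {G : ℂ → ℂ} (hG : Differentiable ℂ G) {A T : ℝ} (hT : 0 ≤ T)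
    (hA : 0 ≤ A) (hbound : ∀ z, ‖G z‖ ≤ A * Real.exp (T * ‖z‖)) {c : ℂ} {R : ℝ} (hR : 0 < R)
    (F : Finset ℂ) (hF : ∀ a ∈ F, G a = 0 ∧ ‖a - c‖ ≤ R) :
    2 ^ F.card * ‖G c‖ ≤ A * Real.exp (T * (‖c‖ + 3 * R)) := by
  obtain ⟨H, hH, hGH⟩ := exists_eq_prod_mul hG F fun a ha => (hF a ha).1
  set M := A * Real.exp (T * (‖c‖ + 3 * R))
  have hM : 0 ≤ M := by positivity
  -- On the circle of radius `3R` every factor `z - a` is at least `2R`, whereas at the centre it is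
  -- at most `R`; the maximum principle for `H` turns this ratio into the factor `2 ^ F.card`.
  have hHc : ‖H c‖ ≤ M / (2 * R) ^ F.card := by
    refine norm_le_of_norm_le_sphere hH (r := 3 * R) (c := c) (by positivity) (fun z hz => ?_)
      (by simp; positivity)
    rw [le_div_iff₀ (by positivity)]
    calc ‖H z‖ * (2 * R) ^ F.card ≤ ‖H z‖ * ∏ a ∈ F, ‖z - a‖ := by
          rw [← Finset.prod_const]
          refine mul_le_mul_of_nonneg_left (Finset.prod_le_prod (fun _ _ => by positivity)
            fun a ha => ?_) (norm_nonneg _)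
          have h1 := (hF a ha).2
          have h2 := norm_sub_norm_le (z - c) (a - c)
          rw [sub_sub_sub_cancel_right] at h2
          linarith
      _ = ‖G z‖ := by rw [hGH, norm_mul, norm_prod, mul_comm]
      _ ≤ A * Real.exp (T * ‖z‖) := hbound z
      _ ≤ M := by
          have h1 := norm_le_insert' z c
          rw [hz] at h1
          exact mul_le_mul_of_nonneg_left
            (Real.exp_le_exp.2 (mul_le_mul_of_nonneg_left h1 hT)) hA
  calc 2 ^ F.card * ‖G c‖ = 2 ^ F.card * ((∏ a ∈ F, ‖c - a‖) * ‖H c‖) := by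
        rw [hGH, norm_mul, norm_prod]
    _ ≤ 2 ^ F.card * (R ^ F.card * (M / (2 * R) ^ F.card)) := by
        gcongr
        rw [← Finset.prod_const]
        exact Finset.prod_le_prod (fun _ _ => norm_nonneg _) fun a ha => by
          rw [norm_sub_rev]; exact (hF a ha).2
    _ = M := by
        rw [mul_pow]
        field_simp

/-- The excluded intervals of length `2h` have total measure less than that of `[R, 2R]`, so they
cannot cover it. -/
lemma exists_mem_Icc_forall_le_abs_sub {F : Finset ℝ} {R h : ℝ} (hh : 0 ≤ h)
    (hlt : F.card * (2 * h) < R) : ∃ r ∈ Icc R (2 * R), ∀ a ∈ F, h ≤ |r - a| := by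
  by_contra! hcon
  have hsub : Icc R (2 * R) ⊆ ⋃ a ∈ F, Ioo (a - h) (a + h) := fun r hr => by
    obtain ⟨a, ha, hra⟩ := hcon r hr
    rw [abs_lt] at hra
    simp only [mem_iUnion, mem_Ioo]
    exact ⟨a, ha, by linarith, by linarith⟩
  have h1 := (measure_mono hsub).trans (measure_biUnion_finset_le (μ := volume) F _)
  simp only [Real.volume_Icc, Real.volume_Ioo] at h1
  have h2 : ∀ x : ℝ, x + h - (x - h) = 2 * h := fun x => by ring
  simp only [h2] at h1
  rw [Finset.sum_const, nsmul_eq_mul, ← ENNReal.ofReal_natCast,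
    ← ENNReal.ofReal_mul (by positivity), ENNReal.ofReal_le_ofReal_iff (by positivity)] at h1
  linarith

variable {J : Type*} {μ : J → ℂ}

/-- The zeros of a function of exponential type stay away from the circles of suitable, arbitrarily
large, radii. -/
lemma exists_radii (hfin : ∀ r : ℝ, {j | ‖μ j‖ ≤ r}.Finite)
    {G : ℂ → ℂ} (hG : Differentiable ℂ G) {A T : ℝ} (hT : 0 ≤ T) (hA : 0 < A)
    (hbound : ∀ z, ‖G z‖ ≤ A * Real.exp (T * ‖z‖)) (hGμ : ∀ j, G (μ j) = 0) {c : ℂ}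
    (hc : G c ≠ 0) :
    ∃ h > 0, ∀ R : ℝ, 1 ≤ R → ∃ r ∈ Icc R (2 * R), ∀ j, h ≤ |r - ‖μ j‖| := by
  classical
  have hc' : 0 < ‖G c‖ := norm_pos_iff.2 hc
  have hlog2 : 0 < Real.log 2 := Real.log_pos one_lt_two
  -- Taking logarithms in the zero count for the disc of radius `3R + ‖c‖` about `c` bounds the
  -- number of `μ j` in `‖z‖ ≤ 3R` by `C R` when `R ≥ 1`. With `h = 1 / (4(C + 1))` the excluded
  -- length is below `R`; points beyond `3R` are at distance at least `R ≥ h` from `[R, 2R]`.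
  set C : ℝ := (|Real.log (A / ‖G c‖)| + T * (4 * ‖c‖ + 9)) / Real.log 2 with hC
  have hC0 : 0 ≤ C := by positivity
  set h : ℝ := 1 / (4 * (C + 1)) with hh
  have hh0 : 0 < h := by positivity
  have hh1 : h ≤ 1 := by
    rw [hh, div_le_one (by positivity)]; linarith
  refine ⟨h, hh0, fun R hR => ?_⟩
  set F : Finset ℂ := (hfin (3 * R)).toFinset.image μ
  have hcard : (F.card : ℝ) ≤ C * R := by
    have h1 := two_pow_card_zeros_mul_le hG hT hA.le hbound (c := c) (R := 3 * R + ‖c‖)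
      (by positivity) F (fun a ha => by
        obtain ⟨j, hj, rfl⟩ := Finset.mem_image.1 ha
        simp only [Finite.mem_toFinset, mem_ofPred_eq] at hj
        exact ⟨hGμ j, (norm_sub_le _ _).trans (by gcongr)⟩)
    rw [← le_div_iff₀ hc', mul_div_right_comm] at h1
    have h2 := Real.log_le_log (by positivity) h1
    rw [Real.log_pow, Real.log_mul (by positivity) (by positivity), Real.log_exp] at h2
    rw [hC, div_mul_eq_mul_div, le_div_iff₀ hlog2]
    have h3 := le_abs_self (Real.log (A / ‖G c‖))
    have h4 := abs_nonneg (Real.log (A / ‖G c‖))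
    have h5 : T * (‖c‖ + 3 * (3 * R + ‖c‖)) ≤ T * (4 * ‖c‖ + 9) * R := by
      rw [mul_assoc]
      gcongr
      nlinarith [norm_nonneg c]
    nlinarith
  obtain ⟨r, hr, hrF⟩ := exists_mem_Icc_forall_le_abs_sub (F := F.image fun a => ‖a‖) (R := R)
    (h := h) hh0.le (by
      have h1 : ((F.image fun a => ‖a‖).card : ℝ) ≤ C * R :=
        (Nat.cast_le.2 Finset.card_image_le).trans hcard
      calc ((F.image fun a => ‖a‖).card : ℝ) * (2 * h) ≤ C * R * (2 * h) := by gcongr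
        _ = R * (C / (2 * (C + 1))) := by rw [hh]; field_simp; ring
        _ < R * 1 := by
          gcongr
          rw [div_lt_one (by positivity)]; linarith
        _ = R := mul_one R)
  refine ⟨r, hr, fun j => ?_⟩
  by_cases hj : ‖μ j‖ ≤ 3 * R
  · refine hrF _ (Finset.mem_image_of_mem _ (Finset.mem_image_of_mem _ ?_))
    simpa using hj
  · rw [abs_sub_comm, le_abs]
    left
    linarith [hr.2]

/-- An entire function of exponential type whose reciprocal is `1` plus an absolutely convergent
sum of simple fractions is constant. -/
theorem apply_eq_apply_of_mul_one_add_tsum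
    (hfin : ∀ r : ℝ, {j | ‖μ j‖ ≤ r}.Finite) {G : ℂ → ℂ} (hG : Differentiable ℂ G) {A T : ℝ}
    (hT : 0 ≤ T) (hA : 0 < A) (hbound : ∀ z, ‖G z‖ ≤ A * Real.exp (T * ‖z‖))
    (hGμ : ∀ j, G (μ j) = 0) {c : ℂ} (hc : G c ≠ 0) {m : J → ℂ} (hm : Summable fun j => ‖m j‖)
    (hsum : ∀ z, (∀ j, z ≠ μ j) → G z * (1 + ∑' j, m j / (z - μ j)) = 1) (z w : ℂ) :
    G z = G w := by
  obtain ⟨h, hh, hrad⟩ := exists_radii hfin hG hT hA hbound hGμ hc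
  choose r hr hrμ using fun n : ℕ => hrad (n + 1) (by simp)
  have hrtop : Tendsto r atTop atTop :=
    tendsto_atTop_mono (fun n => ((lt_add_one (n : ℝ)).le.trans (hr n).1))
      tendsto_natCast_atTop_atTop
  -- On the chosen circles the terms are dominated by `‖m j‖ / h` and each tends to `0`. Once the
  -- sum is below `1/2`, the identity `hsum` gives `‖G‖ ≤ 2` there.
  have hlim : Tendsto (fun n => ∑' j, ‖m j‖ / |r n - ‖μ j‖|) atTop (𝓝 0) := by
    rw [← tsum_zero (β := J)]
    refine tendsto_tsum_of_dominated_convergence (hm.div_const h) (fun j => ?_)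
      (Eventually.of_forall fun n j => ?_)
    · refine Tendsto.div_atTop tendsto_const_nhds (tendsto_abs_atTop_atTop.comp ?_)
      exact tendsto_atTop_add_const_right _ _ hrtop
    · rw [norm_div, norm_norm, Real.norm_eq_abs, abs_abs]
      gcongr
      exact hrμ n j
  have hbd : ∀ᶠ n in atTop, ∀ z, ‖z‖ ≤ r n → ‖G z‖ ≤ 2 := by
    filter_upwards [hlim.eventually (gt_mem_nhds (show (0 : ℝ) < 1 / 2 by norm_num))] with n hn z hz
    have hrn : 0 < r n := lt_of_lt_of_le (by positivity) (hr n).1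
    refine norm_le_of_norm_le_sphere hG (c := 0) hrn (fun ζ hζ => ?_) (by simpa using hz)
    rw [sub_zero] at hζ
    have hdist : ∀ j, |r n - ‖μ j‖| ≤ ‖ζ - μ j‖ := fun j => by
      rw [← hζ]; exact abs_norm_sub_norm_le _ _
    have hpos : ∀ j, 0 < |r n - ‖μ j‖| := fun j => hh.trans_le (hrμ n j)
    have h1 := hsum ζ fun j hj => by
      have := (hpos j).trans_le (hdist j)
      rw [hj, sub_self, norm_zero] at this
      exact lt_irrefl _ this
    have hs : Summable fun j => ‖m j‖ / |r n - ‖μ j‖| :=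
      Summable.of_nonneg_of_le (fun j => by positivity)
        (fun j => div_le_div_of_nonneg_left (norm_nonneg _) hh (hrμ n j)) (hm.div_const h)
    have h2 : ‖∑' j, m j / (ζ - μ j)‖ ≤ 1 / 2 := by
      refine le_trans ?_ hn.le
      refine tsum_of_norm_bounded hs.hasSum fun j => ?_
      rw [norm_div]
      exact div_le_div_of_nonneg_left (norm_nonneg _) (hpos j) (hdist j)
    have h3 : 1 / 2 ≤ ‖1 + ∑' j, m j / (ζ - μ j)‖ := by
      have := norm_sub_le_norm_add (1 : ℂ) (∑' j, m j / (ζ - μ j))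
      rw [norm_one] at this
      linarith
    have h4 := congrArg norm h1
    rw [norm_mul, norm_one] at h4
    nlinarith [norm_nonneg (G ζ)]
  refine hG.apply_eq_apply_of_bounded ?_ z w
  refine (isBounded_iff_forall_norm_le).2 ⟨2, ?_⟩
  rintro _ ⟨z, rfl⟩
  obtain ⟨n, hn, hn'⟩ := (hbd.and (hrtop.eventually_ge_atTop ‖z‖)).exists
  exact hn z hn'

end EntireFunctions

/-! ### Strongly minimal exponentials and their closed span. -/

section Incompleteness

variable {T : ℝ} {J : Type*} {μ c : J → ℂ}

lemma IsStronglyMinimal.ne_zero {H : Type*} [NormedAddCommGroup H] [InnerProductSpace ℂ H]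
    {f : J → H} (hf : IsStronglyMinimal f) (j : J) : f j ≠ 0 := by
  obtain ⟨γ, hγ, h⟩ := hf
  intro h0
  have h1 := h {j} fun _ => 1
  simp [h0] at h1
  linarith

lemma mem_closure_span_of_forall_inner {H : Type*} [NormedAddCommGroup H]
    [InnerProductSpace ℂ H] [CompleteSpace H] {f : J → H} {e : H}
    (h : ∀ u, (∀ j, inner ℂ u (f j) = 0) → inner ℂ u e = 0) :
    e ∈ (Submodule.span ℂ (range f)).topologicalClosure := by
  rw [← Submodule.orthogonal_orthogonal_eq_closure, Submodule.mem_orthogonal]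
  intro u hu
  refine h u fun j => ?_
  rw [Submodule.mem_orthogonal] at hu
  rw [← inner_conj_symm, hu _ (Submodule.subset_span (mem_range_self j)), map_zero]

/-- If `t` is orthogonal to everything that is orthogonal to a family of exponentials which
contains `1`, then this family is complete. -/
lemma laplace_eq_zero_of_forall (hT : 0 ≤ T) {j₀ : J} (hj₀ : μ j₀ = 0)
    (ht : ∀ u : Lp ℂ 2 (volume.restrict (Icc (0 : ℝ) T)), (∀ j, laplace u (μ j) = 0) →
      inner ℂ u (toL2 T (fun t => (t : ℂ)) Complex.continuous_ofReal) = 0)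
    {u : Lp ℂ 2 (volume.restrict (Icc (0 : ℝ) T))} (hu : ∀ j, laplace u (μ j) = 0) (z : ℂ) :
    laplace u z = 0 := by
  have key : ∀ (n : ℕ) (u : Lp ℂ 2 (volume.restrict (Icc (0 : ℝ) T))),
      (∀ j, laplace u (μ j) = 0) → ∃ w : Lp ℂ 2 (volume.restrict (Icc (0 : ℝ) T)),
        (∀ j, laplace w (μ j) = 0) ∧ ∀ z, laplace u z = (-z) ^ n * laplace w z := by
    intro n
    induction n with
    | zero => exact fun u hu => ⟨u, hu, fun z => by simp⟩
    | succ n ih =>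
      intro u hu
      obtain ⟨w, hw⟩ := exists_laplace_div hT u 0
      have hu0 : laplace u 0 = 0 := hj₀ ▸ hu j₀
      have hw' : ∀ z, laplace u z = -z * laplace w z := fun z => by
        have := hw z
        rw [hu0] at this
        linear_combination this
      have hwμ : ∀ j, laplace w (μ j) = 0 := fun j => by
        by_cases hj : μ j = 0
        -- At the exponent `0`, the value of the quotient is the `t`-moment of `u`, which vanishes
        -- by `ht`. Hence `w` is again orthogonal to the family and the division can be iterated.
        · have h1 : HasDerivAt (fun z => -z * laplace w z) (-laplace w 0) 0 :=
            ((hasDerivAt_neg (0 : ℂ)).mul (differentiable_laplace w 0).hasDerivAt).congr_deriv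
              (by simp)
          have h2 := hasDerivAt_laplace_zero u
          rw [show laplace u = _ from funext hw', ht u hu, neg_zero] at h2
          rw [hj]
          exact neg_eq_zero.1 (h1.unique h2)
        · have := hw' (μ j)
          rw [hu j] at this
          exact (mul_eq_zero.1 this.symm).resolve_left (neg_ne_zero.2 hj)
      obtain ⟨w₂, h1, h2⟩ := ih w hwμ
      exact ⟨w₂, h1, fun z => by rw [hw', h2]; ring⟩
  have han : AnalyticOnNhd ℂ (laplace u) univ :=
    (differentiable_laplace u).differentiableOn.analyticOnNhd isOpen_univ
  have htop : analyticOrderAt (laplace u) 0 = ⊤ := by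
    refine ENat.eq_top_iff_forall_ge.2 fun n => ?_
    rw [natCast_le_analyticOrderAt (han 0 (mem_univ _))]
    obtain ⟨w, -, hw⟩ := key n u hu
    refine ⟨fun z => (-1) ^ n * laplace w z, ?_, Eventually.of_forall fun z => ?_⟩
    · exact analyticAt_const.mul
        ((differentiable_laplace w).analyticAt 0)
    · rw [hw, sub_zero, smul_eq_mul, neg_pow]; ring
  rw [analyticOrderAt_eq_top] at htop
  exact han.eqOn_zero_of_preconnected_of_eventuallyEq_zero isPreconnected_univ (mem_univ 0) htop
    (mem_univ z)

/-- A strongly minimal family of exponentials `c_j e^{-μ_j t}` with square summable `c_j` and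
`c_j μ_j` is not complete in `L²[0, T]`. -/
theorem not_forall_mem_closure_span (hT : 0 ≤ T)
    (hfin : ∀ r : ℝ, {j | ‖μ j‖ ≤ r}.Finite) (hμ : Function.Injective μ) [Nonempty J]
    (hc : Summable fun j => ‖c j‖ ^ 2) (hcμ : Summable fun j => ‖c j * μ j‖ ^ 2)
    (hf : IsStronglyMinimal fun j => c j • expL2 T (μ j)) :
    ¬ ∀ z, expL2 T z ∈
      (Submodule.span ℂ (range fun j => c j • expL2 T (μ j))).topologicalClosure := by
  classical
  intro hcomplete
  have hc0 : ∀ j, c j ≠ 0 := fun j h0 => hf.ne_zero j (by simp [h0])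
  have hinner : ∀ u j, inner ℂ u (c j • expL2 T (μ j)) = c j * laplace u (μ j) :=
    fun u j => inner_smul_right _ _ _
  -- `v z` are the weak coefficients of `e^{-zt}` in the family.
  choose v hv hvu using fun z => hf.exists_hasSum_inner (hcomplete z)
  simp only [hinner] at hvu
  obtain ⟨k, hk⟩ := hf.exists_inner_eq c hc
  simp only [hinner] at hk
  have hkμ : ∀ j, laplace k (μ j) = 1 := fun j => mul_left_cancel₀ (hc0 j) (by rw [hk, mul_one])
  set G : ℂ → ℂ := fun z => 1 - laplace k z with hG
  have hGμ : ∀ j, G (μ j) = 0 := fun j => by simp [hG, hkμ]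
  obtain ⟨z₀, hz₀⟩ : ∃ z₀, G z₀ ≠ 0 := by
    have h1 : Tendsto (fun x : ℝ => G x) atTop (𝓝 (1 - 0)) :=
      (tendsto_laplace_atTop k).const_sub 1
    rw [sub_zero] at h1
    obtain ⟨x, hx⟩ := (h1.eventually_ne one_ne_zero).exists
    exact ⟨x, hx⟩
  choose w hw using fun j => exists_laplace_div hT k (μ j)
  have hwG : ∀ j z, (z - μ j) * laplace (w j) z = G z := fun j z => by rw [hw, hkμ]
  have hwij : ∀ i j, j ≠ i → laplace (w i) (μ j) = 0 := fun i j hij => by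
    have h1 := hwG i (μ j)
    rw [hGμ] at h1
    exact (mul_eq_zero.1 h1).resolve_left (sub_ne_zero.2 (hμ.ne hij))
  -- This is `G'(μ j)`, because the transform of `w j` is `G(z) / (z - μ j)`.
  set θ : J → ℂ := fun j => laplace (w j) (μ j) with hθ
  -- Only the `i`-th moment of `w i` can be nonzero, so its expansion reduces to one term and
  -- identifies `v z i`.
  have hwv : ∀ i z, laplace (w i) z = v z i * (c i * θ i) := fun i z => by
    have h0 : ∀ j, j ≠ i → c j * laplace (w i) (μ j) = 0 := fun j hj => by
      rw [hwij i j hj, mul_zero]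
    refine (hvu z (w i) ?_).unique (hasSum_single i fun j hj => by rw [h0 j hj, mul_zero])
    exact summable_of_ne_finset_zero (s := {i}) fun j hj => by
      rw [h0 j (by simpa using hj)]; simp
  have hθ0 : ∀ i, θ i ≠ 0 := fun i h0 => hz₀ (by rw [← hwG i, hwv, h0]; simp)
  have hvG : ∀ z j, (z - μ j) * v z j * c j = G z * (θ j)⁻¹ := fun z j => by
    have := hwG j z
    rw [hwv] at this
    rw [← this]
    field_simp [hθ0 j]
  -- By `hvG` at `z₀`, `(θ j)⁻¹` is, up to `G z₀`, the product of `v z₀ j` and `c j * (z₀ - μ j)`.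
  -- Both are square summable, the second because `c j` and `c j * μ j` are.
  have hm : Summable fun j => ‖(θ j)⁻¹‖ := by
    have h1 : Summable fun j => ‖c j * (z₀ - μ j)‖ ^ 2 := by
      have h2 : Summable fun j => ‖c j * z₀‖ ^ 2 := by
        simp only [norm_mul, mul_pow]; exact hc.mul_right _
      have h3 : Summable fun j => ‖-(c j * μ j)‖ ^ 2 := by simpa only [norm_neg] using hcμ
      exact (summable_sq_add h2 h3).congr fun j => by ring_nf
    refine ((summable_norm_mul_of_sq (hv z₀) h1).mul_left ‖(G z₀)⁻¹‖).congr fun j => ?_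
    rw [← norm_mul]
    congr 1
    have := hvG z₀ j
    rw [show v z₀ j * (c j * (z₀ - μ j)) = (z₀ - μ j) * v z₀ j * c j by ring, this,
      inv_mul_cancel_left₀ hz₀]
  have hsum : ∀ z, (∀ j, z ≠ μ j) → G z * (1 + ∑' j, (θ j)⁻¹ / (z - μ j)) = 1 := by
    intro z hz
    -- Expanding the transform of `k` gives `laplace k = G ∑ (θ j)⁻¹ / (z - μ j)`; adding `G` to
    -- both sides gives `1`.
    have h1 : laplace k z = ∑' j, v z j * c j := by
      have := (hvu z k (by simpa only [hk] using hc)).tsum_eq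
      simp only [hk] at this
      exact this.symm
    have h2 : ∀ j, v z j * c j = G z * ((θ j)⁻¹ / (z - μ j)) := fun j => by
      rw [← mul_div_assoc, ← hvG, mul_assoc, mul_div_cancel_left₀ _ (sub_ne_zero.2 (hz j))]
    simp only [h2, tsum_mul_left] at h1
    rw [mul_add, ← h1]
    simp [hG]
  obtain ⟨C, hC, hCb⟩ := exists_norm_laplace_le k
  have hconst := apply_eq_apply_of_mul_one_add_tsum hfin (G := G)
    ((differentiable_laplace k).const_sub 1) hT (by positivity : 0 < 1 + C) (fun z => by
      have h1 : 1 ≤ Real.exp (T * ‖z‖) := Real.one_le_exp (by positivity)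
      calc ‖G z‖ ≤ ‖(1 : ℂ)‖ + ‖laplace k z‖ := norm_sub_le _ _
        _ ≤ Real.exp (T * ‖z‖) + C * Real.exp (T * ‖z‖) := by
          rw [norm_one]; exact add_le_add h1 (hCb z)
        _ = (1 + C) * Real.exp (T * ‖z‖) := by ring) hGμ hz₀ hm hsum
  obtain ⟨j⟩ := ‹Nonempty J›
  exact hz₀ ((hconst z₀ (μ j)).trans (hGμ j))

/-- In the situation of `not_forall_mem_closure_span`, if moreover `1` belongs to the family, some
function is orthogonal to the family but not to `t`. -/
theorem exists_orthogonal_inner_ofReal_ne_zero (hT : 0 ≤ T)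
    (hfin : ∀ r : ℝ, {j | ‖μ j‖ ≤ r}.Finite) (hμ : Function.Injective μ)
    {j₀ : J} (hj₀ : μ j₀ = 0)
    (hc : Summable fun j => ‖c j‖ ^ 2) (hcμ : Summable fun j => ‖c j * μ j‖ ^ 2)
    (hf : IsStronglyMinimal fun j => c j • expL2 T (μ j)) :
    ∃ u : Lp ℂ 2 (volume.restrict (Icc (0 : ℝ) T)),
      (∀ j, inner ℂ u (c j • expL2 T (μ j)) = 0) ∧
      inner ℂ u (toL2 T (fun t => (t : ℂ)) Complex.continuous_ofReal) ≠ 0 := by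
  by_contra! hcon
  have hc0 : ∀ j, c j ≠ 0 := fun j h0 => hf.ne_zero j (by simp [h0])
  have : Nonempty J := ⟨j₀⟩
  refine not_forall_mem_closure_span hT hfin hμ hc hcμ hf fun z =>
    mem_closure_span_of_forall_inner fun u hu => ?_
  refine laplace_eq_zero_of_forall hT hj₀ (fun u hu => hcon u fun j => ?_) (fun j => ?_) z
  · rw [inner_smul_right]
    exact mul_eq_zero_of_right _ (hu j)
  · have := hu j
    rw [inner_smul_right] at this
    exact (mul_eq_zero.1 this).resolve_left (hc0 j)

end Incompleteness

/-! ### The semigroup and mild solutions in eigencoordinates. -/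

section SpectralSemigroup

variable {X : Type*} [NormedAddCommGroup X] [InnerProductSpace ℂ X] {S : C0Semigroup X}
  {A : X →ₗ.[ℂ] X}

lemma hasDerivWithinAt_op_eigenvector (hA : S.IsGenerator A) {μ : ℂ} {x : X}
    (hx : IsEigenvector A μ x) {t : ℝ} (ht : 0 ≤ t) :
    HasDerivWithinAt (fun t => S.op t x) (μ • S.op t x) (Ici t) t := by
  obtain ⟨-, hxA, hAx⟩ := hx
  have h0 : Tendsto (fun h : ℝ => ((h⁻¹ : ℝ) : ℂ) • (S.op h x - x)) (𝓝[>] 0) (𝓝 (μ • x)) :=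
    (hA x (μ • x)).1 (LinearPMap.mem_graph_iff _ |>.2 ⟨⟨x, hxA⟩, rfl, hAx⟩)
  rw [← hasDerivWithinAt_Ioi_iff_Ici, hasDerivWithinAt_iff_tendsto_slope' self_notMem_Ioi]
  have hshift : Tendsto (fun s => s - t) (𝓝[>] t) (𝓝[>] 0) := by
    refine tendsto_nhdsWithin_iff.2 ⟨?_, ?_⟩
    · refine Tendsto.mono_left ?_ nhdsWithin_le_nhds
      exact (Continuous.tendsto (by fun_prop) t).trans_eq (by simp)
    · filter_upwards [self_mem_nhdsWithin] with s hs using sub_pos.2 (mem_Ioi.1 hs)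
  have h1 := ((S.op t).continuous.tendsto _).comp (h0.comp hshift)
  rw [map_smul] at h1
  refine h1.congr' ?_
  filter_upwards [self_mem_nhdsWithin] with s hs
  have h2 : S.op s x = S.op t (S.op (s - t) x) := by
    have := S.op_add t (s - t) ht (sub_pos.2 (mem_Ioi.1 hs)).le
    rw [add_sub_cancel] at this
    rw [this]; rfl
  rw [slope_def_module, h2, Function.comp_apply, Function.comp_apply, map_smul, map_sub,
    Complex.coe_smul]

/-- The function `e^{-μs} S(s) x` is continuous with zero right derivative, hence constant. -/
lemma op_eigenvector (hA : S.IsGenerator A) {μ : ℂ} {x : X} (hx : IsEigenvector A μ x) {t : ℝ}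
    (ht : 0 ≤ t) : S.op t x = Complex.exp (μ * t) • x := by
  have hderiv : ∀ s ∈ Ico 0 t, HasDerivWithinAt
      (fun s : ℝ => Complex.exp (-μ * s) • S.op s x) 0 (Ici s) s := fun s hs => by
    have h1 := (hasDerivAt_cexp_neg_mul μ s).hasDerivWithinAt.smul
      (hasDerivWithinAt_op_eigenvector hA hx hs.1)
    refine h1.congr_deriv ?_
    rw [smul_smul, ← add_smul]
    ring_nf
    simp
  have hcont : ContinuousOn (fun s : ℝ => Complex.exp (-μ * s) • S.op s x) (Icc 0 t) :=
    (Continuous.continuousOn (by fun_prop)).smul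
      ((S.strongly_continuous x).mono fun s hs => hs.1)
  have h2 := constant_of_has_deriv_right_zero hcont hderiv t (right_mem_Icc.2 ht)
  simp only [Complex.ofReal_zero, mul_zero, Complex.exp_zero, S.op_zero, one_smul,
    ContinuousLinearMap.id_apply] at h2
  nth_rewrite 2 [← h2]
  rw [smul_smul, ← Complex.exp_add]
  simp

variable {ι : Type*} {lam : ι → ℂ} {φ ψ : ι → X}

lemma inner_op [DecidableEq ι] (hA : S.IsGenerator A) (hφ : ∀ j, IsEigenvector A (lam j) (φ j))
    (hφbasis : IsRieszBasis φ)
    (hbio : ∀ i j, inner ℂ (ψ j) (φ i) = if i = j then (1 : ℂ) else 0) {t : ℝ} (ht : 0 ≤ t)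
    (j : ι) (x : X) : inner ℂ (ψ j) (S.op t x) = Complex.exp (lam j * t) * inner ℂ (ψ j) x := by
  have h := ContinuousLinearMap.ext_on (f := (innerSL ℂ (ψ j)).comp (S.op t))
    (g := Complex.exp (lam j * t) • innerSL ℂ (ψ j)) (s := range φ)
    (Submodule.dense_iff_topologicalClosure_eq_top.2 hφbasis.1) (by
      rintro _ ⟨i, rfl⟩
      simp only [ContinuousLinearMap.comp_apply, smul_apply,
        innerSL_apply_apply, op_eigenvector hA (hφ i) ht, inner_smul_right, hbio, smul_eq_mul]
      split_ifs with hij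
      · rw [hij]
      · simp)
  simpa using DFunLike.congr_fun h x

/-- The coordinates of a mild solution. -/
lemma inner_mildSolution [CompleteSpace X] [DecidableEq ι] (hA : S.IsGenerator A)
    (hφ : ∀ j, IsEigenvector A (lam j) (φ j)) (hφbasis : IsRieszBasis φ)
    (hbio : ∀ i j, inner ℂ (ψ j) (φ i) = if i = j then (1 : ℂ) else 0) {T : ℝ} (hT : 0 ≤ T)
    (b x₀ : X) {v : ℝ → ℂ} (hv : ContinuousOn v (Icc 0 T)) (j : ι) :
    inner ℂ (ψ j) (mildSolution S b x₀ v T) = Complex.exp (lam j * T) *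
      (inner ℂ (ψ j) x₀ +
        inner ℂ (ψ j) b * ∫ t in (0 : ℝ)..T, Complex.exp (-lam j * t) * v t) := by
  have hcont : ContinuousOn (fun τ => S.op (T - τ) (v τ • b)) (uIcc 0 T) := by
    rw [uIcc_of_le hT]
    simp only [map_smul]
    refine hv.smul ((S.strongly_continuous b).comp (Continuous.continuousOn (by fun_prop)) ?_)
    exact fun τ hτ => sub_nonneg.2 hτ.2
  have h1 := (innerSL ℂ (ψ j)).intervalIntegral_comp_comm
    (hcont.intervalIntegrable (μ := volume))
  simp only [innerSL_apply_apply] at h1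
  rw [mildSolution, inner_add_right, ← h1, inner_op hA hφ hφbasis hbio hT, mul_add,
    ← intervalIntegral.integral_const_mul, ← intervalIntegral.integral_const_mul]
  congr 1
  refine intervalIntegral.integral_congr fun τ hτ => ?_
  rw [uIcc_of_le hT] at hτ
  rw [inner_op hA hφ hφbasis hbio (sub_nonneg.2 hτ.2), inner_smul_right]
  have h2 : Complex.exp (lam j * ((T - τ : ℝ) : ℂ)) =
      Complex.exp (lam j * T) * Complex.exp (-lam j * τ) := by
    rw [← Complex.exp_add]; push_cast; ring_nf
  rw [h2]; ring

lemma mildSolution_eq_zero_iff [CompleteSpace X] [DecidableEq ι] (hA : S.IsGenerator A)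
    (hφ : ∀ j, IsEigenvector A (lam j) (φ j)) (hφbasis : IsRieszBasis φ)
    (hbio : ∀ i j, inner ℂ (ψ j) (φ i) = if i = j then (1 : ℂ) else 0) {T : ℝ} (hT : 0 ≤ T)
    (b x₀ : X) {v : ℝ → ℂ} (hv : ContinuousOn v (Icc 0 T)) :
    mildSolution S b x₀ v T = 0 ↔ ∀ j, inner ℂ (ψ j) x₀ +
      inner ℂ (ψ j) b * ∫ t in (0 : ℝ)..T, Complex.exp (-lam j * t) * v t = 0 := by
  refine ⟨fun h j => ?_, fun h => hφbasis.eq_zero_of_inner hbio fun j => ?_⟩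
  · have h1 := inner_mildSolution hA hφ hφbasis hbio hT b x₀ hv j
    rw [h, inner_zero_right] at h1
    exact (mul_eq_zero.1 h1.symm).resolve_left (Complex.exp_ne_zero _)
  · rw [inner_mildSolution hA hφ hφbasis hbio hT b x₀ hv j, h, mul_zero]

/-- The coordinates of the terminal state in terms of the derivative of the control. -/
lemma mildSolution_eq_zero_iff_deriv [CompleteSpace X] [DecidableEq ι] (hA : S.IsGenerator A)
    (hφ : ∀ j, IsEigenvector A (lam j) (φ j)) (hφbasis : IsRieszBasis φ)
    (hbio : ∀ i j, inner ℂ (ψ j) (φ i) = if i = j then (1 : ℂ) else 0) {T : ℝ} (hT : 0 ≤ T)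
    (b x₀ : X) {a : ℂ} {v : ℝ → ℂ} (hv : MemH1 T a 0 v) :
    mildSolution S b x₀ v T = 0 ↔
      (∀ j, lam j ≠ 0 → inner ℂ (ψ j) b / lam j *
        ∫ t in (0 : ℝ)..T, Complex.exp (-lam j * t) * deriv v t =
          -(inner ℂ (ψ j) x₀ + a * (inner ℂ (ψ j) b / lam j))) ∧
      ∀ j, lam j = 0 → inner ℂ (ψ j) b * ∫ t in (0 : ℝ)..T, t * deriv v t =
        inner ℂ (ψ j) x₀ := by
  have hvc : ContinuousOn v (Icc 0 T) := by
    have := hv.1.continuousOn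
    rwa [uIcc_of_le hT] at this
  rw [mildSolution_eq_zero_iff hA hφ hφbasis hbio hT b x₀ hvc, ← forall_and]
  refine forall_congr' fun j => ?_
  by_cases hj : lam j = 0
  · simp only [hj, ne_eq, not_true_eq_false, false_imp_iff, true_imp_iff, true_and, neg_zero,
      zero_mul, Complex.exp_zero, one_mul, hv.integral_eq]
    constructor <;> intro h <;> linear_combination -h
  · simp only [hj, ne_eq, not_false_eq_true, false_imp_iff, true_imp_iff, and_true]
    have h1 := hv.mul_integral_exp (lam j)
    rw [mul_comm, ← eq_div_iff hj] at h1
    rw [h1]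
    constructor <;> intro h <;> linear_combination h

end SpectralSemigroup

/-! ### The family `expFamily` and its extended moment problem. -/

section Moments

variable {T : ℝ} {ι : Type*} {lam β : ι → ℂ}

lemma summable_option {α : Type*} {f : Option α → ℝ} (h : Summable fun a => f (some a)) :
    Summable f := by
  classical
  have h1 : Summable fun o => if o = none then 0 else f o :=
    ((Option.some_injective α).summable_iff (by
      rintro (_ | a) ha
      · simp
      · exact absurd ⟨a, rfl⟩ ha)).1 (by simpa [Function.comp_def] using h)
  have h2 : Summable fun o => if o = none then f o else 0 :=
    summable_of_ne_finset_zero (s := {none}) fun o ho => by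
      rw [if_neg (by simpa using ho)]
  exact (h1.add h2).congr fun o => by split_ifs <;> simp

lemma summable_sq_dite_option {d : Option {j : ι // lam j ≠ 0} → ℂ}
    [∀ j, Decidable (lam j ≠ 0)] (hd : Summable fun k => ‖d k‖ ^ 2) :
    Summable fun j => ‖(if h : lam j ≠ 0 then d (some ⟨j, h⟩) else 0 : ℂ)‖ ^ 2 := by
  refine (Subtype.val_injective (p := fun j => lam j ≠ 0)).summable_iff (fun j hj => ?_) |>.1 ?_
  · rw [dif_neg (by simpa using hj)]; simp
  · refine (hd.comp_injective (Option.some_injective _)).congr fun j => ?_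
    simp [j.2]

lemma exists_norm_div_le (hfin : ∀ r : ℝ, {j | ‖lam j‖ ≤ r}.Finite) (β : ι → ℂ) :
    ∃ C : ℝ, ∀ j, ‖β j / lam j‖ ≤ C * ‖β j‖ := by
  -- Only finitely many `lam j` lie in the unit disc, and a zero eigenvalue contributes `0⁻¹ = 0`.
  have hbdd : BddAbove ((fun j => ‖(lam j)⁻¹‖) '' {j | ‖lam j‖ ≤ 1}) :=
    ((hfin 1).image _).bddAbove
  obtain ⟨C, hC⟩ := hbdd
  refine ⟨max C 1, fun j => ?_⟩
  rw [div_eq_mul_inv, norm_mul, mul_comm]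
  refine mul_le_mul_of_nonneg_right ?_ (norm_nonneg _)
  by_cases hj : ‖lam j‖ ≤ 1
  · exact (hC ⟨j, hj, rfl⟩).trans (le_max_left _ _)
  · rw [norm_inv]
    exact (inv_le_one_of_one_le₀ (not_le.1 hj).le).trans (le_max_right _ _)

/-- The exponents of the family `expFamily`. -/
def famExponent (lam : ι → ℂ) : Option {j : ι // lam j ≠ 0} → ℂ
  | none => 0
  | some j => lam j

/-- The coefficients of the family `expFamily`. -/
noncomputable def famCoeff (lam β : ι → ℂ) : Option {j : ι // lam j ≠ 0} → ℂ
  | none => 1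
  | some j => β j / lam j

lemma smul_toL2 (c : ℂ) {f g : ℝ → ℂ} (hf : Continuous f) (hg : Continuous g)
    (h : ∀ t, g t = c * f t) : toL2 T g hg = c • toL2 T f hf := by
  obtain rfl : g = c • f := funext h
  exact MemLp.toLp_const_smul _ _

lemma expFamily_eq (k : Option {j : ι // lam j ≠ 0}) :
    expFamily T lam β k = famCoeff lam β k • expL2 T (famExponent lam k) := by
  cases k with
  | none => exact smul_toL2 _ (by fun_prop) continuous_const fun t => by simp [famCoeff, famExponent]
  | some j => exact smul_toL2 _ (by fun_prop) (by fun_prop) fun t => by simp [famCoeff, famExponent]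

lemma famExponent_injective (hlam : Function.Injective lam) :
    Function.Injective (famExponent lam) := by
  rintro (_ | i) (_ | j) h
  · rfl
  · exact absurd h.symm j.2
  · exact absurd h i.2
  · exact congrArg some (Subtype.ext (hlam h))

lemma finite_norm_famExponent_le (hfin : ∀ r : ℝ, {j | ‖lam j‖ ≤ r}.Finite) (r : ℝ) :
    {k | ‖famExponent lam k‖ ≤ r}.Finite := by
  have h1 : ({j : {j : ι // lam j ≠ 0} | ‖lam j‖ ≤ r}).Finite :=
    (hfin r).preimage Subtype.val_injective.injOn
  refine ((h1.image some).insert none).subset ?_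
  rintro (_ | j) hj
  · exact mem_insert _ _
  · exact mem_insert_of_mem _ ⟨j, hj, rfl⟩

lemma summable_sq_famCoeff (hfin : ∀ r : ℝ, {j | ‖lam j‖ ≤ r}.Finite)
    (hβ : Summable fun j => ‖β j‖ ^ 2) : Summable fun k => ‖famCoeff lam β k‖ ^ 2 := by
  obtain ⟨C, hC⟩ := exists_norm_div_le hfin β
  exact summable_option ((summable_sq_of_le hβ hC).comp_injective Subtype.val_injective)

lemma summable_sq_famCoeff_mul (hβ : Summable fun j => ‖β j‖ ^ 2) :
    Summable fun k => ‖famCoeff lam β k * famExponent lam k‖ ^ 2 := by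
  refine summable_option ((hβ.comp_injective
    (Subtype.val_injective (p := fun j => lam j ≠ 0))).congr fun j => ?_)
  simp only [Function.comp_apply, famCoeff, famExponent]
  rw [div_mul_cancel₀ _ j.2]

/-- For a square summable right-hand side, the moment problem of a strongly minimal `expFamily`
can be solved together with a prescribed moment with respect to `t`. -/
lemma exists_moments (hT : 0 ≤ T) (hlam : Function.Injective lam)
    (hfin : ∀ r : ℝ, {j | ‖lam j‖ ≤ r}.Finite) (hβ : Summable fun j => ‖β j‖ ^ 2)
    (hf : IsStronglyMinimal (expFamily T lam β)) {d : Option {j : ι // lam j ≠ 0} → ℂ}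
    (hd : Summable fun k => ‖d k‖ ^ 2) (τ : ℂ) :
    ∃ u : Lp ℂ 2 (volume.restrict (Icc (0 : ℝ) T)),
      (∀ k, inner ℂ u (expFamily T lam β k) = d k) ∧
      inner ℂ u (toL2 T (fun t => (t : ℂ)) Complex.continuous_ofReal) = τ := by
  obtain ⟨u, hu⟩ := hf.exists_inner_eq d hd
  have hf' : IsStronglyMinimal fun k => famCoeff lam β k • expL2 T (famExponent lam k) := by
    simpa only [← expFamily_eq] using hf
  obtain ⟨y, hy, hyt⟩ := exists_orthogonal_inner_ofReal_ne_zero hT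
    (finite_norm_famExponent_le hfin) (famExponent_injective hlam) (j₀ := none) rfl
    (summable_sq_famCoeff hfin hβ) (summable_sq_famCoeff_mul hβ) hf'
  set e := toL2 T (fun t => (t : ℂ)) Complex.continuous_ofReal
  -- Moving along `y` keeps the moments of the family and adjusts the one against `t`; the conjugate
  -- compensates for conjugate linearity in the first argument.
  refine ⟨u + conj ((τ - inner ℂ u e) / inner ℂ y e) • y, fun k => ?_, ?_⟩
  · rw [inner_add_left, inner_smul_left, expFamily_eq, hy, mul_zero, add_zero, ← expFamily_eq, hu]
  · rw [inner_add_left, inner_smul_left, Complex.conj_conj, div_mul_cancel₀ _ hyt]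
    ring

lemma inner_toLp_conj (hT : 0 ≤ T) {u : ℝ → ℂ} (hu : MemLp u 2 (volume.restrict (Icc 0 T)))
    (f : ℝ → ℂ) (hf : Continuous f) :
    inner ℂ (memLp_conj hu).toLp (toL2 T f hf) = ∫ t in (0 : ℝ)..T, f t * u t := by
  rw [inner_toL2, intervalIntegral.integral_of_le hT, ← integral_Icc_eq_integral_Ioc]
  refine integral_congr_ae ?_
  filter_upwards [(memLp_conj hu).coeFn_toLp] with t ht
  rw [ht, Complex.conj_conj]

lemma inner_expFamily_none (hT : 0 ≤ T) (u : Lp ℂ 2 (volume.restrict (Icc (0 : ℝ) T))) :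
    inner ℂ u (expFamily T lam β none) = ∫ t in (0 : ℝ)..T, conj (u t) := by
  rw [expFamily, inner_toL2_interval hT]
  simp

lemma inner_expFamily_some (hT : 0 ≤ T) (u : Lp ℂ 2 (volume.restrict (Icc (0 : ℝ) T)))
    (j : {j : ι // lam j ≠ 0}) :
    inner ℂ u (expFamily T lam β (some j)) =
      β j / lam j * ∫ t in (0 : ℝ)..T, Complex.exp (-lam j * t) * conj (u t) := by
  rw [expFamily, inner_toL2_interval hT, ← intervalIntegral.integral_const_mul]
  simp only [mul_assoc]

lemma interval_integral_congr_restrict (hT : 0 ≤ T) {f g : ℝ → ℂ}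
    (h : f =ᵐ[volume.restrict (Icc 0 T)] g) :
    ∫ t in (0 : ℝ)..T, f t = ∫ t in (0 : ℝ)..T, g t := by
  rw [intervalIntegral.integral_of_le hT, intervalIntegral.integral_of_le hT,
    ← integral_Icc_eq_integral_Ioc, ← integral_Icc_eq_integral_Ioc]
  exact integral_congr_ae h

end Moments

/-! ### Controllability and strong minimality. -/

section Main

variable {X : Type*} [NormedAddCommGroup X] [InnerProductSpace ℂ X] [CompleteSpace X]
  {S : C0Semigroup X} {A : X →ₗ.[ℂ] X} {ι : Type*} {lam : ι → ℂ} {φ ψ : ι → X} {b : X} {T : ℝ}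

lemma ExactNullControllableSmooth.isStronglyMinimal [DecidableEq ι] (hA : S.IsGenerator A)
    (hfin : ∀ r : ℝ, {j | ‖lam j‖ ≤ r}.Finite)
    (hφ : ∀ j, IsEigenvector A (lam j) (φ j)) (hφbasis : IsRieszBasis φ)
    (hbio : ∀ i j, inner ℂ (ψ j) (φ i) = if i = j then (1 : ℂ) else 0) (hT : 0 ≤ T)
    (h : ExactNullControllableSmooth S b T) :
    IsStronglyMinimal (expFamily T lam fun j => inner ℂ (ψ j) b) := by
  classical
  set β : ι → ℂ := fun j => inner ℂ (ψ j) b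
  have hβ : Summable fun j => ‖β j‖ ^ 2 := hφbasis.summable_sq_inner hbio b
  refine isStronglyMinimal_of_forall_exists fun d hd => ?_
  -- With `a = -d none`, these coordinates of `x₀` make the required moments `-(x₀ⱼ + a βⱼ/λⱼ)`
  -- equal to `d`. At a zero eigenvalue `β j / lam j` is `0`, so that coordinate is `0`.
  have hx : Summable fun j => ‖-(if h : lam j ≠ 0 then d (some ⟨j, h⟩) else 0) +
      d none * (β j / lam j)‖ ^ 2 := by
    refine summable_sq_add ?_ ?_
    · simpa only [norm_neg] using summable_sq_dite_option hd
    · obtain ⟨C, hC⟩ := exists_norm_div_le hfin β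
      simp only [norm_mul, mul_pow]
      exact (summable_sq_of_le hβ hC).mul_left _
  obtain ⟨x₀, hx₀⟩ := hφbasis.exists_inner_eq hbio hx
  obtain ⟨v, hv, hv0⟩ := h x₀ (-d none)
  have hvd := (mildSolution_eq_zero_iff_deriv hA hφ hφbasis hbio hT b x₀ hv).1 hv0
  refine ⟨(memLp_conj hv.2.1).toLp, ?_⟩
  rintro (_ | ⟨j, hj⟩)
  · rw [expFamily, inner_toLp_conj hT hv.2.1]
    simp only [one_mul]
    rw [integral_deriv_eq_sub_complex hv.1, hv.2.2.1, hv.2.2.2]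
    simp
  · rw [expFamily, inner_toLp_conj hT hv.2.1]
    simp only [mul_assoc, intervalIntegral.integral_const_mul]
    rw [hvd.1 j hj, hx₀, dif_pos hj]
    ring

/-- If this coefficient of `b` were zero, no control could act on the coordinate `j`, and the
initial state `φ j` could not be steered to zero. -/
lemma ExactNullControllableSmooth.inner_ne_zero [DecidableEq ι] (hA : S.IsGenerator A)
    (hφ : ∀ j, IsEigenvector A (lam j) (φ j)) (hφbasis : IsRieszBasis φ)
    (hbio : ∀ i j, inner ℂ (ψ j) (φ i) = if i = j then (1 : ℂ) else 0) (hT : 0 ≤ T)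
    (h : ExactNullControllableSmooth S b T) {j : ι} (hj : lam j = 0) :
    inner ℂ (ψ j) b ≠ 0 := by
  intro h0
  obtain ⟨v, hv, hv0⟩ := h (φ j) 0
  have h1 := ((mildSolution_eq_zero_iff_deriv hA hφ hφbasis hbio hT b _ hv).1 hv0).2 j hj
  rw [h0, zero_mul, hbio, if_pos rfl] at h1
  exact zero_ne_one h1

lemma exactNullControllableSmooth_of_isStronglyMinimal [DecidableEq ι] (hA : S.IsGenerator A)
    (hlam : Function.Injective lam) (hfin : ∀ r : ℝ, {j | ‖lam j‖ ≤ r}.Finite)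
    (hφ : ∀ j, IsEigenvector A (lam j) (φ j)) (hφbasis : IsRieszBasis φ)
    (hbio : ∀ i j, inner ℂ (ψ j) (φ i) = if i = j then (1 : ℂ) else 0) (hT : 0 ≤ T)
    (hb : ∀ j, lam j = 0 → inner ℂ (ψ j) b ≠ 0)
    (hf : IsStronglyMinimal (expFamily T lam fun j => inner ℂ (ψ j) b)) :
    ExactNullControllableSmooth S b T := by
  intro x₀ a
  have hβ : Summable fun j => ‖inner ℂ (ψ j) b‖ ^ 2 := hφbasis.summable_sq_inner hbio b
  let d : Option {j : ι // lam j ≠ 0} → ℂ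
    | none => -a
    | some j => -(inner ℂ (ψ j) x₀ + a * (inner ℂ (ψ j) b / lam j))
  have hd : Summable fun k => ‖d k‖ ^ 2 := by
    refine summable_option ?_
    simp only [d, norm_neg]
    have h1 : Summable fun j => ‖inner ℂ (ψ j) x₀ + a * (inner ℂ (ψ j) b / lam j)‖ ^ 2 := by
      refine summable_sq_add (hφbasis.summable_sq_inner hbio x₀) ?_
      obtain ⟨C, hC⟩ := exists_norm_div_le hfin fun j => inner ℂ (ψ j) b
      simp only [norm_mul, mul_pow]
      exact (summable_sq_of_le hβ hC).mul_left _
    exact h1.comp_injective Subtype.val_injective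
  -- `τ` is the required `t`-moment of `v'`. Injectivity of `lam` leaves at most one equation for
  -- it, and without a zero eigenvalue any value works.
  obtain ⟨τ, hτ⟩ : ∃ τ : ℂ, ∀ j, lam j = 0 → inner ℂ (ψ j) b * τ = inner ℂ (ψ j) x₀ := by
    by_cases h : ∃ i, lam i = 0
    · obtain ⟨i, hi⟩ := h
      refine ⟨inner ℂ (ψ i) x₀ / inner ℂ (ψ i) b, fun j hj => ?_⟩
      obtain rfl := hlam (hj.trans hi.symm)
      exact mul_div_cancel₀ _ (hb j hj)
    · exact ⟨0, fun j hj => absurd ⟨j, hj⟩ h⟩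
  obtain ⟨u, hud, hut⟩ := exists_moments hT hlam hfin hβ hf hd τ
  obtain ⟨v, hv, hvu⟩ := exists_memH1 hT (memLp_conj (Lp.memLp u)) (a := a)
    (by rw [← inner_expFamily_none (lam := lam) (β := fun j => inner ℂ (ψ j) b) hT, hud])
  refine ⟨v, hv, (mildSolution_eq_zero_iff_deriv hA hφ hφbasis hbio hT b x₀ hv).2
    ⟨fun j hj => ?_, fun j hj => ?_⟩⟩
  · have h1 := hud (some ⟨j, hj⟩)
    rw [inner_expFamily_some hT] at h1
    rw [interval_integral_congr_restrict hT (g := fun t => Complex.exp (-lam j * t) * conj (u t))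
      (by filter_upwards [hvu] with t ht; rw [ht])]
    exact h1
  · rw [interval_integral_congr_restrict hT (g := fun t => (t : ℂ) * conj (u t))
      (by filter_upwards [hvu] with t ht; rw [ht]), ← inner_toL2_interval hT u _
        Complex.continuous_ofReal, hut, hτ j hj]

end Main

end NullControl

theorem theorem3p1
    {X : Type*} [NormedAddCommGroup X] [InnerProductSpace ℂ X] [CompleteSpace X]
    [TopologicalSpace.SeparableSpace X]
    -- `A` generates the strongly continuous semigroup `S`
    (S : NullControl.C0Semigroup X) (A : X →ₗ.[ℂ] X) (hA : S.IsGenerator A) (b : X)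
    -- the spectrum of `A` consists of simple eigenvalues, enumerated without repetition by `lam`,
    -- and has no finite limit points
    {ι : Type*} (lam : ι → ℂ) (hlam : Function.Injective lam)
    (hspec : NullControl.opSpectrum A = Set.range lam)
    (hsimple : ∀ j, NullControl.IsSimpleEigenvalue A (lam j))
    (hdiscrete : ∀ r : ℝ, {j | ‖lam j‖ ≤ r}.Finite)
    -- Riesz basis of eigenvectors of `A`
    (φ : ι → X) (hφ : ∀ j, NullControl.IsEigenvector A (lam j) (φ j))
    (hφbasis : NullControl.IsRieszBasis φ)
    -- the biorthogonal eigenvectors of the adjoint operator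
    (ψ : ι → X) (hψ : ∀ j, NullControl.IsEigenvector A† (conj (lam j)) (ψ j))
    (hφψ : ∀ j, inner ℂ (ψ j) (φ j) = 1) (hφψ' : ∀ i j, i ≠ j → inner ℂ (ψ j) (φ i) = 0)
    (t₁ : ℝ) (ht₁ : 0 < t₁) :
    NullControl.ExactNullControllableSmooth S b t₁ ↔
      (0 ∉ NullControl.opSpectrum A ∨
        (0 ∈ NullControl.opSpectrum A ∧ ∀ j, lam j = 0 → inner ℂ (ψ j) b ≠ 0)) ∧
      NullControl.IsStronglyMinimal
        (NullControl.expFamily t₁ lam (fun j => inner ℂ (ψ j) b)) := by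
  classical
  have hbio : ∀ i j, inner ℂ (ψ j) (φ i) = if i = j then (1 : ℂ) else 0 := fun i j => by
    split_ifs with h
    · rw [h, hφψ]
    · exact hφψ' i j h
  constructor
  · intro h
    refine ⟨?_, h.isStronglyMinimal hA hdiscrete hφ hφbasis hbio ht₁.le⟩
    by_cases h0 : 0 ∈ NullControl.opSpectrum A
    · exact Or.inr ⟨h0, fun j hj => h.inner_ne_zero hA hφ hφbasis hbio ht₁.le hj⟩
    · exact Or.inl h0
  · rintro ⟨h0, hf⟩
    refine NullControl.exactNullControllableSmooth_of_isStronglyMinimal hA hlam hdiscrete hφ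
      hφbasis hbio ht₁.le (fun j hj => ?_) hf
    rcases h0 with h0 | ⟨-, h0⟩
    · rw [hspec] at h0
      exact absurd ⟨j, hj⟩ h0
    · exact h0 j hj
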